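/- Let $k$ be a field, let $\mathbb{S}^1=\mathbb{R}/2\pi\mathbb{Z}$ be the circle and let $e\colon\mathbb{R}\to\mathbb{S}^1$ be the quotient map. A sheaf $F$ of $k$-vector spaces on $\mathbb{S}^1$ is called constructible if there is a real analytic stratification of $\mathbb{S}^1$ (a locally finite partition into connected real analytic submanifolds, that is, into points and connected open subsets) such that the restriction of $F$ to each stratum is a constant sheaf of finite rank. For an interval $I\subset\mathbb{R}$ and $n\in\mathbb{N}$ let $k^n_I$ be the sheaf on $\mathbb{R}$ obtained by extending by zero the constant sheaf with fibre $k^n$ on $I$. Let $F$ be a constructible sheaf of $k$-vector spaces on $\mathbb{S}^1$. Then there exist a finite family $\{(I_a,n_a)\}_{a\in A}$, where each $I_a$ is a (nonempty) bounded interval of $\mathbb{R}$ (open, closed or half-open, possibly reduced to a point) and $n_a\in\mathbb{N}$, and a locally constant sheaf $L$ of $k$-vector spaces of finite rank on $\mathbb{S}^1$, such that $$F \simeq L \oplus \bigoplus_{a\in A} e_*\bigl(k^{n_a}_{I_a}\bigr).$$ -/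

import Mathlib

open CategoryTheory CategoryTheory.Limits TopologicalSpace Topology

namespace CircleSheaf

universe u

noncomputable section

/-! ### Restriction to subsets, constant and locally constant sheaves -/

/-- The category of sheaves of `k`-vector spaces on a topological space `X`. -/
abbrev Sh (k : Type u) [Field k] (X : TopCat.{u}) :=
  TopCat.Sheaf (ModuleCat.{u} k) X

instance hasFiniteBiproducts_sh (k : Type u) [Field k] (X : TopCat.{u}) :
    HasFiniteBiproducts (Sh k X) :=
  Abelian.hasFiniteBiproducts

/-- The inclusion of a subset, with the subspace topology. -/
def incl {X : TopCat.{u}} (Z : Set X) : TopCat.of Z ⟶ X :=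
  TopCat.ofHom ⟨Subtype.val, continuous_subtype_val⟩

/-- The restriction `F|_Z` (inverse image) of a sheaf to a subset `Z`. -/
def restrict {k : Type u} [Field k] {X : TopCat.{u}} (F : Sh k X) (Z : Set X) :
    Sh k (TopCat.of Z) :=
  (TopCat.Sheaf.pullback (ModuleCat.{u} k) (incl Z)).obj F

/-- `F` is isomorphic to the constant sheaf associated with a finite-dimensional vector space. -/
def IsConstantOfFiniteRank {k : Type u} [Field k] {X : TopCat.{u}} (F : Sh k X) : Prop :=
  ∃ M : ModuleCat.{u} k, Module.Finite k M ∧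
    Nonempty (F ≅ (constantSheaf (Opens.grothendieckTopology X) (ModuleCat.{u} k)).obj M)

/-- Every point has an open neighbourhood on which `F` is constant of finite rank. -/
def IsLocallyConstantOfFiniteRank {k : Type u} [Field k] {X : TopCat.{u}} (F : Sh k X) : Prop :=
  ∀ x : X, ∃ U : Set X, IsOpen U ∧ x ∈ U ∧ IsConstantOfFiniteRank (restrict F U)

/-! ### Constructible sheaves on a one-dimensional real analytic manifold -/

/-- Stratifications of a one-dimensional real analytic manifold `X`: locally finite partitions of
`X` into (nonempty) connected real analytic submanifolds. In dimension one the connected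
submanifolds are the points and the connected open subsets, and the closure of a stratum is
automatically a union of strata. -/
structure IsStratification {X : Type u} [TopologicalSpace X] (S : Set (Set X)) : Prop where
  isPartition : Setoid.IsPartition S
  locallyFinite : LocallyFinite (fun s : S => (s : Set X))
  isConnected : ∀ s ∈ S, IsConnected s
  point_or_open : ∀ s ∈ S, (∃ x, s = {x}) ∨ IsOpen s

/-- A sheaf on a one-dimensional real analytic manifold is constructible if there is a
stratification such that the restriction of the sheaf to each stratum is constant of finite rank. -/
def IsConstructible {k : Type u} [Field k] {X : TopCat.{u}} (F : Sh k X) : Prop :=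
  ∃ S : Set (Set X), IsStratification S ∧ ∀ s ∈ S, IsConstantOfFiniteRank (restrict F s)

/-! ### The sheaf `V_Z`: the constant sheaf on a locally closed subset, extended by zero -/

/-- The functions `f : U → V` that represent the sections over the open set `U` of the extension by
zero of the constant sheaf `V` on `Z`: `f` is zero outside `Z`, its restriction to `U ∩ Z` is
locally constant, and its support is closed in `U`. -/
structure IsExtSection {X : Type u} [TopologicalSpace X] (Z : Set X) {V : Type u} [Zero V]
    {U : Set X} (f : U → V) : Prop where
  zero_off : ∀ x : U, x.1 ∉ Z → f x = 0
  locConst : IsLocallyConstant (fun x : {x : U // x.1 ∈ Z} => f x.1)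
  closed_support : IsClosed (Function.support f)

theorem isExtSection_iff {X : Type u} [TopologicalSpace X] (Z : Set X) {V : Type u} [Zero V]
    {U : Set X} (f : U → V) :
    IsExtSection Z f ↔ ∀ x : U, (x.1 ∉ Z → ∀ᶠ y in 𝓝 x, f y = 0) ∧
      (x.1 ∈ Z → ∀ᶠ y in 𝓝 x, y.1 ∈ Z → f y = f x) := by
  constructor
  · intro h x
    refine ⟨fun hx => ?_, fun hx => ?_⟩
    · have h1 : x ∈ (Function.support f)ᶜ := by simpa using h.zero_off x hx
      filter_upwards [h.closed_support.isOpen_compl.mem_nhds h1] with y hy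
      simpa using hy
    · have h1 := (IsLocallyConstant.iff_eventually_eq _).1 h.locConst ⟨x, hx⟩
      rw [nhds_subtype_eq_comap, Filter.eventually_comap] at h1
      filter_upwards [h1] with y hy hyZ
      exact hy ⟨y, hyZ⟩ rfl
  · intro h
    refine ⟨fun x hx => ((h x).1 hx).self_of_nhds, ?_, ?_⟩
    · rw [IsLocallyConstant.iff_eventually_eq]
      rintro ⟨x, hx⟩
      rw [nhds_subtype_eq_comap, Filter.eventually_comap]
      filter_upwards [(h x).2 hx] with y hy
      rintro ⟨z, hz⟩ rfl
      exact hy hz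
    · rw [← isOpen_compl_iff, isOpen_iff_mem_nhds]
      intro x hx
      have hx0 : f x = 0 := by simpa using hx
      by_cases hZ : x.1 ∈ Z
      · filter_upwards [(h x).2 hZ] with y hy
        by_cases hyZ : y.1 ∈ Z
        · simp [hy hyZ, hx0]
        · simp [((h y).1 hyZ).self_of_nhds]
      · filter_upwards [(h x).1 hZ] with y hy
        simp [hy]

/-- The property `IsExtSection` is local on `U`. -/
def extLocalPredicate (X : TopCat.{u}) (Z : Set X) (V : Type u) [Zero V] :
    TopCat.LocalPredicate (fun _ : X => V) where
  pred {U} f := IsExtSection Z (U := (U : Set X)) f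
  res {U W} i f h := by
    rw [isExtSection_iff] at h ⊢
    intro x
    have hc : Filter.Tendsto (fun y : U => (⟨y.1, i.le y.2⟩ : W)) (𝓝 x) (𝓝 ⟨x.1, i.le x.2⟩) :=
      (continuous_inclusion i.le).tendsto x
    exact ⟨fun hx => hc.eventually ((h _).1 hx), fun hx => hc.eventually ((h _).2 hx)⟩
  locality {U} f w := by
    rw [isExtSection_iff]
    intro x
    obtain ⟨W, hx, i, h⟩ := w x
    rw [isExtSection_iff] at h
    have hm : Filter.map (fun y : W => (⟨y.1, i.le y.2⟩ : U)) (𝓝 ⟨x.1, hx⟩) = 𝓝 x :=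
      (Opens.isOpenEmbedding_of_le i.le).map_nhds_eq ⟨x.1, hx⟩
    rw [← hm]
    exact ⟨fun hz => (h ⟨x.1, hx⟩).1 hz, fun hz => (h ⟨x.1, hx⟩).2 hz⟩

/-- The vector space of sections over `U` of the extension by zero of the constant sheaf `V`
on `Z`. -/
def extSections (k : Type u) [Field k] (X : TopCat.{u}) (Z : Set X) (V : Type u)
    [AddCommGroup V] [Module k V] (U : Opens X) : Submodule k (U → V) where
  carrier := {f | (extLocalPredicate X Z V).pred f}
  zero_mem' := by
    refine (isExtSection_iff Z _).2 fun x => ?_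
    simp
  add_mem' {f g} hf hg := by
    refine (isExtSection_iff Z _).2 fun x => ⟨fun hx => ?_, fun hx => ?_⟩
    · filter_upwards [((isExtSection_iff Z _).1 hf x).1 hx,
        ((isExtSection_iff Z _).1 hg x).1 hx] with y h1 h2
      simp [h1, h2]
    · filter_upwards [((isExtSection_iff Z _).1 hf x).2 hx,
        ((isExtSection_iff Z _).1 hg x).2 hx] with y h1 h2 hy
      simp [h1 hy, h2 hy]
  smul_mem' c f hf := by
    refine (isExtSection_iff Z _).2 fun x => ⟨fun hx => ?_, fun hx => ?_⟩
    · filter_upwards [((isExtSection_iff Z _).1 hf x).1 hx] with y h1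
      simp [h1]
    · filter_upwards [((isExtSection_iff Z _).1 hf x).2 hx] with y h1 hy
      simp [h1 hy]

/-- The underlying presheaf of `V_Z`; the restriction maps are the restrictions of functions. -/
def extPresheaf (k : Type u) [Field k] (X : TopCat.{u}) (Z : Set X) (V : Type u)
    [AddCommGroup V] [Module k V] : TopCat.Presheaf (ModuleCat.{u} k) X where
  obj U := ModuleCat.of k (extSections k X Z V U.unop)
  map {U W} i := ModuleCat.ofHom
    { toFun := fun f => ⟨fun x => f.1 ⟨x.1, i.unop.le x.2⟩,
        (extLocalPredicate X Z V).res i.unop f.1 f.2⟩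
      map_add' := fun _ _ => rfl
      map_smul' := fun _ _ => rfl }

theorem extPresheaf_isSheaf (k : Type u) [Field k] (X : TopCat.{u}) (Z : Set X) (V : Type u)
    [AddCommGroup V] [Module k V] : (extPresheaf k X Z V).IsSheaf :=
  (TopCat.Presheaf.isSheaf_iff_isSheaf_comp (forget (ModuleCat.{u} k)) _).2
    (TopCat.subpresheafToTypes.isSheaf (extLocalPredicate X Z V))

/-- The sheaf `V_Z` on `X`, for `Z` locally closed in `X`: the constant sheaf with fibre `V` on `Z`,
extended by zero to `X`. -/
def extSheaf (k : Type u) [Field k] (X : TopCat.{u}) (Z : Set X) (V : Type u)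
    [AddCommGroup V] [Module k V] : Sh k X :=
  ⟨extPresheaf k X Z V, extPresheaf_isSheaf k X Z V⟩

/-! ### The line, the circle and the quotient map -/

/-- The real line (lifted to the universe of the coefficient field). -/
def line : TopCat.{u} := TopCat.of (ULift.{u} ℝ)

/-- The circle `ℝ / 2πℤ` (lifted to the universe of the coefficient field). -/
def circle : TopCat.{u} := TopCat.of (ULift.{u} (AddCircle (2 * Real.pi)))

/-- The quotient map `e : ℝ → ℝ / 2πℤ`. -/
def e : line.{u} ⟶ circle.{u} :=
  TopCat.ofHom ⟨fun x => ULift.up (x.down : AddCircle (2 * Real.pi)),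
    continuous_uliftUp.comp ((AddCircle.continuous_mk' (2 * Real.pi)).comp continuous_uliftDown)⟩

/-- The sheaf `k^n_I` on the real line. -/
def intervalSheaf (k : Type u) [Field k] (I : Set ℝ) (n : ℕ) : Sh k line.{u} :=
  extSheaf k line.{u} (ULift.down ⁻¹' I) (Fin n → k)

/-- Bounded (nonempty) intervals of `ℝ`: open, closed or half-open, including one-point ones. -/
structure IsBoundedInterval (I : Set ℝ) : Prop where
  nonempty : I.Nonempty
  ordConnected : I.OrdConnected
  isBounded : Bornology.IsBounded I

/-- The direct image functor `e_*`. -/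
abbrev eDirectImage (k : Type u) [Field k] : Sh k line.{u} ⥤ Sh k circle.{u} :=
  TopCat.Sheaf.pushforward (ModuleCat.{u} k) e

end

end CircleSheaf

/-!
Choose a `2π`-periodic subdivision of the line whose points of even index lie over a finite set
containing all point strata. The sections of `F` over the open arcs around consecutive subdivision
points are finite-dimensional spaces, and agreement on overlaps makes them a `ℤ`-indexed periodic
chain of linear relations `C`. If every `C i` relates `0` only to `0` on its right and has full
image, then by periodicity all the `C i` are graphs of isomorphisms, and `F` is locally constant.

Otherwise one of these two conditions fails at some `i`, hence at infinitely many indices. Push the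
zero space, or the whole space, at `i` and at `i + 1` along the chain. If the two results stayed
different for ever, for each such `i`, they would form ever longer strict chains of subspaces,
against the bound on the dimensions. Where they become equal, one finds a finite chain `x` of
elements and a chain `t` of functionals with `t x = 1` which split off at both ends. They define
morphisms `e_* k_I ⟶ F ⟶ e_* k_I`, for `I` the bounded interval on which `x` lives. The diagonal
part of their composition `f` is the identity. The pairing of `t` with the translate of `x` by a
nonzero multiple of `2π` is constant along the overlap, and the left end condition makes it vanish
for the translates in one direction. So `1 - f` moves supports by at least `2π` in one direction and
is nilpotent because `I` is bounded. Thus `f` is invertible, `e_* k_I` is a direct summand of `F`,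
and the kernel of `F ⟶ e_* k_I` has smaller spaces of sections over the arcs.
-/

namespace CircleSheaf

open Opposite

universe u

noncomputable section

/-! ### Chains of linear relations -/

namespace LinRel

universe v

section Reach

variable {R : Type*} [Semiring R] {V W : Type*} [AddCommMonoid V] [Module R V]
  [AddCommMonoid W] [Module R W]

/-- The image of a submodule under a linear relation, a relation from `V` to `W` being a submodule
of `V × W`. -/
def relImage (C : Submodule R (V × W)) (S : Submodule R V) : Submodule R W :=
  (C ⊓ S.comap (LinearMap.fst R V W)).map (LinearMap.snd R V W)

theorem mem_relImage {C : Submodule R (V × W)} {S : Submodule R V} {y : W} :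
    y ∈ relImage C S ↔ ∃ x ∈ S, (x, y) ∈ C := by
  simp [relImage, and_comm]

theorem relImage_mono (C : Submodule R (V × W)) {S T : Submodule R V} (h : S ≤ T) :
    relImage C S ≤ relImage C T := fun y hy => by
  obtain ⟨x, hx, hxy⟩ := mem_relImage.1 hy
  exact mem_relImage.2 ⟨x, h hx, hxy⟩

theorem mem_relImage_bot {C : Submodule R (V × W)} {y : W} :
    y ∈ relImage C ⊥ ↔ (0, y) ∈ C := by
  simp [mem_relImage]

theorem mem_relImage_top {C : Submodule R (V × W)} {y : W} :
    y ∈ relImage C ⊤ ↔ ∃ x, (x, y) ∈ C := by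
  simp [mem_relImage]

variable {X : ℤ → Type v} [∀ i, AddCommMonoid (X i)] [∀ i, Module R (X i)]
  {C : ∀ i, Submodule R (X i × X (i + 1))}

/-- The elements of `X n` that end a chain of the relations `C` starting in `S ≤ X a`; for `n < a`
this is all of `X n`. -/
def reach (C : ∀ i, Submodule R (X i × X (i + 1))) (a : ℤ) (S : Submodule R (X a)) (n : ℤ) :
    Submodule R (X n) where
  carrier := {y | ∃ x : ∀ i, X i, x a ∈ S ∧ x n = y ∧
    ∀ i, a ≤ i → i < n → (x i, x (i + 1)) ∈ C i}
  zero_mem' := ⟨0, S.zero_mem, rfl, fun i _ _ => (C i).zero_mem⟩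
  add_mem' := by
    rintro _ _ ⟨x, hx, rfl, h⟩ ⟨x', hx', rfl, h'⟩
    exact ⟨x + x', S.add_mem hx hx', rfl, fun i h1 h2 => (C i).add_mem (h i h1 h2) (h' i h1 h2)⟩
  smul_mem' := by
    rintro c _ ⟨x, hx, rfl, h⟩
    exact ⟨c • x, S.smul_mem c hx, rfl, fun i h1 h2 => (C i).smul_mem c (h i h1 h2)⟩

theorem mem_reach {a n : ℤ} {S : Submodule R (X a)} {y : X n} :
    y ∈ reach C a S n ↔ ∃ x : ∀ i, X i, x a ∈ S ∧ x n = y ∧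
      ∀ i, a ≤ i → i < n → (x i, x (i + 1)) ∈ C i := Iff.rfl

theorem reach_self (a : ℤ) (S : Submodule R (X a)) : reach C a S a = S := by
  ext y
  rw [mem_reach]
  constructor
  · rintro ⟨x, hx, rfl, -⟩
    exact hx
  · intro hy
    exact ⟨Function.update 0 a y, by simpa using hy, by simp, fun i h1 h2 => by omega⟩

theorem reach_mono {a : ℤ} {S T : Submodule R (X a)} (h : S ≤ T) (n : ℤ) :
    reach C a S n ≤ reach C a T n := by
  rintro y ⟨x, hx, hy, hc⟩
  exact ⟨x, h hx, hy, hc⟩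

theorem reach_succ {a n : ℤ} (han : a ≤ n) (S : Submodule R (X a)) :
    reach C a S (n + 1) = relImage (C n) (reach C a S n) := by
  ext y
  rw [mem_relImage]
  constructor
  · rintro ⟨x, hx, rfl, hc⟩
    exact ⟨x n, ⟨x, hx, rfl, fun i h1 h2 => hc i h1 (by omega)⟩, hc n han (by omega)⟩
  · rintro ⟨_, ⟨x, hx, rfl, hc⟩, h⟩
    refine ⟨Function.update x (n + 1) y, ?_, by simp, fun i h1 h2 => ?_⟩
    · rwa [Function.update_of_ne (by omega)]
    · rcases (show i < n ∨ i = n by omega) with h3 | rfl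
      · rw [Function.update_of_ne (by omega), Function.update_of_ne (by omega)]
        exact hc i h1 h3
      · rwa [Function.update_of_ne (by omega), Function.update_self]

theorem reach_succ_start {a n : ℤ} (han : a + 1 ≤ n) (S : Submodule R (X a)) :
    reach C (a + 1) (relImage (C a) S) n = reach C a S n := by
  induction n, han using Int.leInduction with
  | base => rw [reach_self, reach_succ le_rfl, reach_self]
  | succ n han ih => rw [reach_succ han, reach_succ (by omega), ih]

end Reach

section Ring

variable {R : Type*} [Ring R] {V W : Type*} [AddCommGroup V] [Module R V]
  [AddCommGroup W] [Module R W]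

theorem relImage_lt_relImage {C : Submodule R (V × W)} {A B : Submodule R V} (hAB : A < B)
    (hker : ∀ y ∈ B, (y, 0) ∈ C → y ∈ A) (hdom : B ≤ A ⊔ C.map (LinearMap.fst R V W)) :
    relImage C A < relImage C B := by
  refine lt_of_le_not_ge (relImage_mono C hAB.le) fun hle => ?_
  obtain ⟨x, hxB, hxA⟩ := SetLike.exists_of_lt hAB
  obtain ⟨b, hb, _, ⟨⟨d, y⟩, hdy, rfl⟩, rfl⟩ := Submodule.mem_sup.1 (hdom hxB)
  have hdB : d ∈ B := (Submodule.add_mem_iff_right B (hAB.le hb)).1 hxB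
  have hdA : d ∉ A := fun hd => hxA (A.add_mem hb hd)
  obtain ⟨b', hb', hb'y⟩ := mem_relImage.1 (hle (mem_relImage.2 ⟨d, hdB, hdy⟩))
  have hdiff : d - b' ∈ A :=
    hker _ (B.sub_mem hdB (hAB.le hb')) (by simpa using C.sub_mem hdy hb'y)
  exact hdA ((Submodule.sub_mem_iff_left A hb').1 hdiff)

end Ring

section Field

variable {k : Type*} [Field k]

theorem exists_dual_comp_eq {V W : Type*} [AddCommGroup V] [Module k V] [AddCommGroup W]
    [Module k W] (f : V →ₗ[k] W) (g : Module.Dual k V) (h : LinearMap.ker f ≤ LinearMap.ker g) :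
    ∃ t : Module.Dual k W, t ∘ₗ f = g := by
  suffices g ∈ LinearMap.range f.dualMap from this
  rw [LinearMap.range_dualMap_eq_dualAnnihilator_ker, Submodule.mem_dualAnnihilator]
  exact fun w hw => h hw

theorem exists_dual_eq_one_of_notMem {V : Type*} [AddCommGroup V] [Module k V]
    {S : Submodule k V} {x : V} (hx : x ∉ S) :
    ∃ f : Module.Dual k V, (∀ y ∈ S, f y = 0) ∧ f x = 1 := by
  obtain ⟨f, hf, hS⟩ := Submodule.exists_le_ker_of_notMem hx
  refine ⟨(f x)⁻¹ • f, fun y hy => ?_, ?_⟩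
  · simp [LinearMap.mem_ker.1 (hS hy)]
  · simp [hf]

theorem exists_dual_pullback {V W : Type*} [AddCommGroup V] [Module k V] [AddCommGroup W]
    [Module k W] (C : Submodule k (V × W)) (A : Submodule k V) (f : Module.Dual k W)
    (hf : ∀ y ∈ relImage C A, f y = 0) :
    ∃ g : Module.Dual k V, (∀ y ∈ A, g y = 0) ∧ ∀ p ∈ C, g p.1 = f p.2 := by
  obtain ⟨g, hg⟩ := exists_dual_comp_eq
    ((LinearMap.fst k V W ∘ₗ C.subtype).coprod A.subtype)
    ((f ∘ₗ LinearMap.snd k V W ∘ₗ C.subtype).coprod 0) (by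
      rintro ⟨⟨⟨y, y'⟩, hy⟩, ⟨b, hb⟩⟩ (h : y + b = 0)
      have hyA : y ∈ A := eq_neg_of_add_eq_zero_left h ▸ A.neg_mem hb
      simpa using hf y' (mem_relImage.2 ⟨y, hyA, hy⟩))
  refine ⟨g, fun y hy => ?_, fun p hp => ?_⟩
  · simpa using LinearMap.congr_fun hg (0, ⟨y, hy⟩)
  · simpa using LinearMap.congr_fun hg (⟨p, hp⟩, 0)

variable {X : ℤ → Type v} [∀ i, AddCommGroup (X i)] [∀ i, Module k (X i)]
  {C : ∀ i, Submodule k (X i × X (i + 1))}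

theorem exists_dual_chain {a n : ℤ} (han : a ≤ n) (A : Submodule k (X a)) (f : Module.Dual k (X n))
    (hf : ∀ y ∈ reach C a A n, f y = 0) :
    ∃ t : ∀ i, Module.Dual k (X i), t n = f ∧ (∀ y ∈ A, t a y = 0) ∧
      ∀ i, a ≤ i → i < n → ∀ p ∈ C i, t i p.1 = t (i + 1) p.2 := by
  induction n, han using Int.leInduction with
  | base =>
    rw [reach_self] at hf
    exact ⟨Function.update 0 a f, by simp, by simpa using hf, fun i h1 h2 => by omega⟩
  | succ n han ih =>
    rw [reach_succ han] at hf
    obtain ⟨g, hgA, hg⟩ := exists_dual_pullback _ _ f hf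
    obtain ⟨t, rfl, htA, ht⟩ := ih g hgA
    refine ⟨Function.update t (n + 1) f, by simp, ?_, fun i h1 h2 p hp => ?_⟩
    · rwa [Function.update_of_ne (by omega)]
    · rcases (show i < n ∨ i = n by omega) with h3 | rfl
      · rw [Function.update_of_ne (by omega), Function.update_of_ne (by omega)]
        exact ht i h1 h3 p hp
      · rw [Function.update_of_ne (by omega), Function.update_self]
        exact hg p hp

/-- A chain `x` of elements together with a chain `t` of functionals compatible with the relations,
on the index interval `[a, n]`, that pair to `1`. -/
structure IsPairedChain (C : ∀ i, Submodule k (X i × X (i + 1))) (a n : ℤ) (x : ∀ j, X j)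
    (t : ∀ j, Module.Dual k (X j)) : Prop where
  le : a ≤ n
  chain : ∀ j, a ≤ j → j < n → (x j, x (j + 1)) ∈ C j
  dual_chain : ∀ j, a ≤ j → j < n → ∀ p ∈ C j, t j p.1 = t (j + 1) p.2
  pairing : t n (x n) = 1

theorem IsPairedChain.pairing_eq_one {a n : ℤ} {x : ∀ j, X j} {t : ∀ j, Module.Dual k (X j)}
    (h : IsPairedChain C a n x t) {j : ℤ} (haj : a ≤ j) (hjn : j ≤ n) : t j (x j) = 1 := by
  induction j, hjn using Int.leInductionDown with
  | base => exact h.pairing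
  | pred j hjn ih =>
    have hstep := h.dual_chain (j - 1) haj (by omega) _ (h.chain (j - 1) haj (by omega))
    rw [sub_add_cancel] at hstep
    rw [hstep, ih (by omega)]

/-- A paired chain on `[i + 1, n]` with the end conditions that make it split off: at each end
either the elements extend by zero or the functionals do. -/
structure IsString (C : ∀ i, Submodule k (X i × X (i + 1))) (i n : ℤ) (x : ∀ j, X j)
    (t : ∀ j, Module.Dual k (X j)) : Prop extends IsPairedChain C (i + 1) n x t where
  left : (0, x (i + 1)) ∈ C i ∨ ∀ p ∈ C i, t (i + 1) p.2 = 0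
  right : (x n, 0) ∈ C n ∨ ∀ p ∈ C n, t n p.1 = 0

theorem exists_isPairedChain {a n : ℤ} (han : a ≤ n) {A B : Submodule k (X a)} {y : X n}
    (hy : y ∈ reach C a B n) {f : Module.Dual k (X n)} (hf : ∀ z ∈ reach C a A n, f z = 0)
    (hfy : f y = 1) :
    ∃ x t, IsPairedChain C a n x t ∧ x a ∈ B ∧ (∀ z ∈ A, t a z = 0) ∧ x n = y ∧ t n = f := by
  obtain ⟨x, hxB, rfl, hx⟩ := hy
  obtain ⟨t, rfl, htA, ht⟩ := exists_dual_chain han A f hf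
  exact ⟨x, t, ⟨han, hx, ht, hfy⟩, hxB, htA, rfl, rfl⟩

theorem reach_lt_or_exists_isPairedChain {a : ℤ} {A B : Submodule k (X a)} (hAB : A < B) :
    (∀ n, a ≤ n → reach C a A n < reach C a B n) ∨
      ∃ n x t, IsPairedChain C a n x t ∧ x a ∈ B ∧ (∀ z ∈ A, t a z = 0) ∧
        ((x n, 0) ∈ C n ∨ ∀ p ∈ C n, t n p.1 = 0) := by
  rw [or_iff_not_imp_right]
  intro hno n han
  induction n, han using Int.leInduction with
  | base => rwa [reach_self, reach_self]
  | succ n han ih =>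
    rw [reach_succ han, reach_succ han]
    refine relImage_lt_relImage ih (fun y hyB hyC => ?_) fun y hyB => ?_ <;> by_contra hyA
    · obtain ⟨f, hf, hfy⟩ := exists_dual_eq_one_of_notMem hyA
      obtain ⟨x, t, hxt, hxB, htA, rfl, -⟩ := exists_isPairedChain han hyB hf hfy
      exact hno ⟨n, x, t, hxt, hxB, htA, Or.inl hyC⟩
    · obtain ⟨f, hf, hfy⟩ := exists_dual_eq_one_of_notMem hyA
      obtain ⟨x, t, hxt, hxB, htA, -, rfl⟩ := exists_isPairedChain han hyB
        (fun z hz => hf z (Submodule.mem_sup_left hz)) hfy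
      exact hno ⟨n, x, t, hxt, hxB, htA, Or.inr fun p hp =>
        hf _ (Submodule.mem_sup_right ⟨p, hp, rfl⟩)⟩

theorem reach_bot_lt_or_exists_isString {i : ℤ} (hi : relImage (C i) ⊥ ≠ ⊥) :
    (∀ n, i + 1 ≤ n → reach C (i + 1) ⊥ n < reach C i ⊥ n) ∨ ∃ n x t, IsString C i n x t := by
  refine (reach_lt_or_exists_isPairedChain (C := C) (bot_lt_iff_ne_bot.2 hi)).imp
    (fun h n hn => by simpa only [reach_succ_start hn] using h n hn) ?_
  rintro ⟨n, x, t, hxt, hx, -, hright⟩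
  exact ⟨n, x, t, hxt, Or.inl (mem_relImage_bot.1 hx), hright⟩

theorem reach_top_lt_or_exists_isString {i : ℤ} (hi : relImage (C i) ⊤ ≠ ⊤) :
    (∀ n, i + 1 ≤ n → reach C i ⊤ n < reach C (i + 1) ⊤ n) ∨ ∃ n x t, IsString C i n x t := by
  refine (reach_lt_or_exists_isPairedChain (C := C) (lt_top_iff_ne_top.2 hi)).imp
    (fun h n hn => by simpa only [reach_succ_start hn] using h n hn) ?_
  rintro ⟨n, x, t, hxt, -, ht, hright⟩
  exact ⟨n, x, t, hxt, Or.inr fun p hp => ht _ (mem_relImage_top.2 ⟨p.1, hp⟩), hright⟩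

theorem exists_forall_le_of_frequently_lt {r : ℤ → ℤ → ℕ}
    (hmono : ∀ i n, i + 1 ≤ n → r i n ≤ r (i + 1) n)
    (hlt : ∃ᶠ i in Filter.atTop, ∀ n, i + 1 ≤ n → r i n < r (i + 1) n) (j : ℕ) :
    ∃ i, ∀ n, i ≤ n → j ≤ r i n := by
  induction j with
  | zero => exact ⟨0, fun n _ => Nat.zero_le _⟩
  | succ j ih =>
    obtain ⟨i, hi⟩ := ih
    obtain ⟨i', hii', hi'⟩ := Filter.frequently_atTop.1 hlt i
    have hle : ∀ n, i' ≤ n → j ≤ r i' n := by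
      clear hi'
      induction i', hii' using Int.leInduction with
      | base => exact hi
      | succ l _ ih => exact fun n hn => (ih n (by omega)).trans (hmono l n hn)
    exact ⟨i' + 1, fun n hn => (hle n (by omega)).trans_lt (hi' n hn)⟩

section FiniteRank

variable [∀ i, Module.Finite k (X i)]

theorem exists_isString_of_frequently_relImage_bot_ne (B : ℕ)
    (hB : ∀ i, Module.finrank k (X i) ≤ B)
    (hC : ∃ᶠ i in Filter.atTop, relImage (C i) ⊥ ≠ ⊥) : ∃ i n x t, IsString C i n x t := by
  by_contra hno
  have hle : ∀ i n, Module.finrank k (reach C i ⊥ n) ≤ B :=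
    fun i n => (Submodule.finrank_le _).trans (hB n)
  have hmono : ∀ i n, i + 1 ≤ n → reach C (i + 1) ⊥ n ≤ reach C i ⊥ n :=
    fun i n hn => reach_succ_start (C := C) hn ⊥ ▸ reach_mono bot_le n
  obtain ⟨i, hi⟩ := exists_forall_le_of_frequently_lt
    (r := fun i n => B - Module.finrank k (reach C i ⊥ n))
    (fun i n hn => Nat.sub_le_sub_left (Submodule.finrank_mono (hmono i n hn)) B)
    (hC.mono fun i hi n hn => by
      have hlt := (reach_bot_lt_or_exists_isString hi).resolve_right (fun h => hno ⟨i, h⟩) n hn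
      exact Nat.sub_lt_sub_left ((Submodule.finrank_lt_finrank_of_lt hlt).trans_le (hle i n))
        (Submodule.finrank_lt_finrank_of_lt hlt)) (B + 1)
  have := hi i le_rfl
  omega

theorem exists_isString_of_frequently_relImage_top_ne (B : ℕ)
    (hB : ∀ i, Module.finrank k (X i) ≤ B)
    (hC : ∃ᶠ i in Filter.atTop, relImage (C i) ⊤ ≠ ⊤) : ∃ i n x t, IsString C i n x t := by
  by_contra hno
  have hmono : ∀ i n, i + 1 ≤ n → reach C i ⊤ n ≤ reach C (i + 1) ⊤ n :=
    fun i n hn => reach_succ_start (C := C) hn ⊤ ▸ reach_mono le_top n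
  obtain ⟨i, hi⟩ := exists_forall_le_of_frequently_lt
    (r := fun i n => Module.finrank k (reach C i ⊤ n))
    (fun i n hn => Submodule.finrank_mono (hmono i n hn))
    (hC.mono fun i hi n hn => Submodule.finrank_lt_finrank_of_lt <|
      (reach_top_lt_or_exists_isString hi).resolve_right (fun h => hno ⟨i, h⟩) n hn) (B + 1)
  have := (hi i le_rfl).trans ((Submodule.finrank_le _).trans (hB i))
  omega

/-- The dimensions decrease weakly along `ℤ`, so by periodicity they are constant. -/
theorem bijective_of_periodic {T : ℤ} (hT : 0 < T)
    (hper : ∀ i, Module.finrank k (X (i + T)) = Module.finrank k (X i))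
    (hbot : ∀ i, relImage (C i) ⊥ = ⊥) (htop : ∀ i, relImage (C i) ⊤ = ⊤) (i : ℤ) :
    (∀ x, (x, 0) ∈ C i → x = 0) ∧ ∀ x, ∃ y, (x, y) ∈ C i := by
  have hfst : ∀ i, Function.Injective (LinearMap.fst k _ _ ∘ₗ (C i).subtype) := fun i => by
    rw [injective_iff_map_eq_zero]
    rintro ⟨⟨_, y⟩, h⟩ (rfl : _ = 0)
    obtain rfl : y = 0 := by simpa [hbot] using mem_relImage_bot.2 h
    rfl
  have hsnd : ∀ i, Function.Surjective (LinearMap.snd k _ _ ∘ₗ (C i).subtype) := fun i y => by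
    obtain ⟨x, hx⟩ := mem_relImage_top.1 (htop i ▸ Submodule.mem_top : y ∈ relImage (C i) ⊤)
    exact ⟨⟨(x, y), hx⟩, rfl⟩
  have hle_fst : ∀ i, Module.finrank k (C i) ≤ Module.finrank k (X i) := fun i =>
    LinearMap.finrank_le_finrank_of_injective (hfst i)
  have hle_snd : ∀ i, Module.finrank k (X (i + 1)) ≤ Module.finrank k (C i) := fun i =>
    LinearMap.finrank_le_finrank_of_surjective (hsnd i)
  have hanti : Antitone fun i => Module.finrank k (X i) :=
    antitone_int_of_succ_le fun i => (hle_snd i).trans (hle_fst i)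
  have hle : Module.finrank k (X i) ≤ Module.finrank k (X (i + 1)) :=
    hper i ▸ hanti (by omega)
  constructor
  · intro x hx
    have hinj : Function.Injective (LinearMap.snd k _ _ ∘ₗ (C i).subtype) :=
      (LinearMap.injective_iff_surjective_of_finrank_eq_finrank
        (((hle_fst i).trans hle).antisymm (hle_snd i))).2 (hsnd i)
    exact congrArg (fun z : C i => z.1.1) (@hinj ⟨(x, 0), hx⟩ 0 (by simp))
  · intro x
    have hsurj : Function.Surjective (LinearMap.fst k _ _ ∘ₗ (C i).subtype) :=
      (LinearMap.injective_iff_surjective_of_finrank_eq_finrank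
        ((hle_fst i).antisymm (hle.trans (hle_snd i)))).1 (hfst i)
    obtain ⟨⟨⟨_, y⟩, h⟩, rfl⟩ := hsurj x
    exact ⟨y, h⟩

end FiniteRank

end Field

end LinRel

/-! ### Sections and germs of sheaves of vector spaces -/

section

variable {k : Type u} [Field k] {X : TopCat.{u}}

/-- The vector space of sections of `F` over `U`. -/
abbrev Sections (F : Sh k X) (U : Opens X) : ModuleCat.{u} k := F.presheaf.obj (op U)

/-- The stalk of `F` at `x`. -/
abbrev Stalk (F : Sh k X) (x : X) : ModuleCat.{u} k := F.presheaf.stalk x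

/-- The restriction of sections, as a linear map. -/
def res (F : Sh k X) {U V : Opens X} (h : U ≤ V) : Sections F V →ₗ[k] Sections F U :=
  (F.presheaf.map (homOfLE h).op).hom

/-- The germ of a section at a point, as a linear map. -/
def germ (F : Sh k X) {U : Opens X} {x : X} (h : x ∈ U) : Sections F U →ₗ[k] Stalk F x :=
  (F.presheaf.germ U x h).hom

/-- The action of a morphism of sheaves on sections. -/
def mapSections {F G : Sh k X} (f : F ⟶ G) (U : Opens X) : Sections F U →ₗ[k] Sections G U :=
  (f.hom.app (op U)).hom

/-- The action of a morphism of sheaves on stalks. -/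
def mapStalk {F G : Sh k X} (f : F ⟶ G) (x : X) : Stalk F x →ₗ[k] Stalk G x :=
  ((TopCat.Presheaf.stalkFunctor (ModuleCat.{u} k) x).map f.hom).hom

section

variable (F : Sh k X)

@[simp] theorem res_self {U : Opens X} (h : U ≤ U) (s : Sections F U) : res F h s = s := by
  simp [res]

@[simp] theorem res_res {U V W : Opens X} (h : U ≤ V) (h' : V ≤ W) (s : Sections F W) :
    res F h (res F h' s) = res F (h.trans h') s :=
  (congrArg (fun f => f.hom s) (F.presheaf.map_comp (homOfLE h').op (homOfLE h).op)).symm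

@[simp] theorem germ_res {U V : Opens X} (h : U ≤ V) {x : X} (hx : x ∈ U) (s : Sections F V) :
    germ F hx (res F h s) = germ F (h hx) s :=
  TopCat.Presheaf.germ_res_apply F.presheaf (homOfLE h) x hx s

theorem section_ext {U : Opens X} {s t : Sections F U}
    (h : ∀ x (hx : x ∈ U), germ F hx s = germ F hx t) : s = t :=
  TopCat.Presheaf.section_ext F U s t h

theorem exists_germ_eq {x : X} (v : Stalk F x) {V : Opens X} (hV : x ∈ V) :
    ∃ (U : Opens X) (_ : U ≤ V) (hx : x ∈ U) (s : Sections F U), germ F hx s = v := by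
  obtain ⟨U, h, hx, s, hs⟩ := TopCat.Presheaf.exists_le_germ_eq F.presheaf v hV
  exact ⟨U, h, hx, s, hs⟩

theorem exists_res_eq_of_germ_eq {U V : Opens X} {x : X} (hU : x ∈ U) (hV : x ∈ V)
    {s : Sections F U} {t : Sections F V} (h : germ F hU s = germ F hV t) :
    ∃ (W : Opens X) (_ : x ∈ W) (h1 : W ≤ U) (h2 : W ≤ V), res F h1 s = res F h2 t := by
  obtain ⟨W, hx, i, j, hW⟩ := TopCat.Presheaf.germ_eq F.presheaf x hU hV s t h
  exact ⟨W, hx, i.le, j.le, hW⟩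

theorem exists_section_germ_eq {U : Opens X} (g : ∀ x, x ∈ U → Stalk F x)
    (hg : ∀ x ∈ U, ∃ (V : Opens X) (_ : x ∈ V) (h : V ≤ U) (s : Sections F V),
      ∀ y (hy : y ∈ V), germ F hy s = g y (h hy)) :
    ∃ s : Sections F U, ∀ x (hx : x ∈ U), germ F hx s = g x hx := by
  choose V hxV hVU s hs using fun x : U => hg x.1 x.2
  obtain ⟨σ, hσ, -⟩ := F.existsUnique_gluing' V U (fun x => homOfLE (hVU x))
    (fun x hx => Opens.mem_iSup.2 ⟨⟨x, hx⟩, hxV _⟩) s fun x y =>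
      section_ext F fun z hz => ((germ_res F inf_le_left hz (s x)).trans (hs x z hz.1)).trans
        ((germ_res F inf_le_right hz (s y)).trans (hs y z hz.2)).symm
  refine ⟨σ, fun x hx => ?_⟩
  have hres : res F (hVU ⟨x, hx⟩) σ = s ⟨x, hx⟩ := hσ ⟨x, hx⟩
  rw [← germ_res F (hVU ⟨x, hx⟩) (hxV ⟨x, hx⟩), hres, hs]

theorem exists_section_sup {U V : Opens X} (s : Sections F U) (t : Sections F V)
    (h : res F (inf_le_left : U ⊓ V ≤ U) s = res F (inf_le_right : U ⊓ V ≤ V) t) :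
    ∃ σ : Sections F (U ⊔ V), res F le_sup_left σ = s ∧ res F le_sup_right σ = t := by
  classical
  have hagree : ∀ x (hU : x ∈ U) (hV : x ∈ V), germ F hU s = germ F hV t := fun x hU hV => by
    rw [← germ_res F (inf_le_left : U ⊓ V ≤ U) (Opens.mem_inf.2 ⟨hU, hV⟩) s, h,
      germ_res]
  obtain ⟨σ, hσ⟩ := exists_section_germ_eq F (U := U ⊔ V)
    (fun x hx => if hU : x ∈ U then germ F hU s else germ F (hx.resolve_left hU) t) (by
      rintro x (hx | hx)
      · exact ⟨U, hx, le_sup_left, s, fun y hy => by rw [dif_pos hy]⟩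
      · refine ⟨V, hx, le_sup_right, t, fun y hy => ?_⟩
        split_ifs with hU
        · exact (hagree y hU hy).symm
        · rfl)
  refine ⟨σ, section_ext F fun x hx => ?_, section_ext F fun x hx => ?_⟩
  · rw [germ_res, hσ, dif_pos hx]
  · rw [germ_res, hσ]
    split_ifs with hU
    · exact hagree x hU hx
    · rfl

end

section

variable {F G : Sh k X} (f : F ⟶ G)

@[simp] theorem mapStalk_germ {U : Opens X} {x : X} (hx : x ∈ U) (s : Sections F U) :
    mapStalk f x (germ F hx s) = germ G hx (mapSections f U s) :=
  TopCat.Presheaf.stalkFunctor_map_germ_apply U x hx f.hom s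

@[simp] theorem mapSections_id (U : Opens X) (s : Sections F U) : mapSections (𝟙 F) U s = s := rfl

@[simp] theorem mapSections_comp {H : Sh k X} (g : G ⟶ H) (U : Opens X) (s : Sections F U) :
    mapSections (f ≫ g) U s = mapSections g U (mapSections f U s) := rfl

theorem isIso_of_mapStalk_bijective (h : ∀ x, Function.Bijective (mapStalk f x)) : IsIso f := by
  have : ∀ x, IsIso ((TopCat.Presheaf.stalkFunctor (ModuleCat.{u} k) x).map f.hom) := fun x =>
    (ConcreteCategory.isIso_iff_bijective _).2 (h x)
  exact TopCat.Presheaf.isIso_of_stalkFunctor_map_iso f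

theorem mapStalk_bijective [IsIso f] (x : X) : Function.Bijective (mapStalk f x) :=
  (ConcreteCategory.isIso_iff_bijective
    ((TopCat.Sheaf.forget (ModuleCat.{u} k) X ⋙
      TopCat.Presheaf.stalkFunctor (ModuleCat.{u} k) x).map f)).1 inferInstance

/-- The morphism of sheaves given by linear maps on sections compatible with restriction. -/
def homMk (φ : ∀ U, Sections F U →ₗ[k] Sections G U)
    (h : ∀ (U V : Opens X) (hUV : U ≤ V) (s : Sections F V),
      φ U (res F hUV s) = res G hUV (φ V s)) : F ⟶ G :=
  ObjectProperty.homMk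
    { app := fun U => ModuleCat.ofHom (φ U.unop)
      naturality := by
        intro U V i
        ext s
        exact h V.unop U.unop i.unop.le s }

end

/-! ### Constant sheaves -/

section Constant

/-- The constant presheaf, whose sheafification is the constant sheaf. -/
abbrev constPresheaf (X : TopCat.{u}) (M : ModuleCat.{u} k) :
    TopCat.Presheaf (ModuleCat.{u} k) X :=
  (Functor.const (Opens X)ᵒᵖ).obj M

theorem constPresheaf_germ_bijective (M : ModuleCat.{u} k) (x : X) :
    Function.Bijective ((constPresheaf X M).germ ⊤ x (Opens.mem_top x)) := by
  constructor
  · intro m m' h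
    obtain ⟨_, _, _, _, hmm'⟩ := TopCat.Presheaf.germ_eq (constPresheaf X M) x _ _ m m' h
    exact hmm'
  · intro a
    obtain ⟨U, hU, m, rfl⟩ := TopCat.Presheaf.exists_germ_eq (constPresheaf X M) a
    exact ⟨m, (TopCat.Presheaf.germ_res_apply (constPresheaf X M) (homOfLE le_top) x hU m).symm⟩

/-- The constant sheaf with fibre `M`. -/
abbrev constSheaf (X : TopCat.{u}) (M : ModuleCat.{u} k) : Sh k X :=
  (constantSheaf (Opens.grothendieckTopology X) (ModuleCat.{u} k)).obj M

/-- The constant global sections of the constant sheaf. -/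
def constSections (X : TopCat.{u}) (M : ModuleCat.{u} k) : M →ₗ[k] Sections (constSheaf X M) ⊤ :=
  ((toSheafify (Opens.grothendieckTopology X) (constPresheaf X M)).app (op ⊤)).hom

theorem germ_comp_constSections_bijective (M : ModuleCat.{u} k) (x : X) :
    Function.Bijective (germ (constSheaf X M) (Opens.mem_top x) ∘ₗ constSections X M) := by
  have hunit := (ConcreteCategory.isIso_iff_bijective _).1
    (TopCat.Presheaf.stalkFunctor_map_unit_toSheafify_isIso x (ModuleCat.{u} k)
      (constPresheaf X M))
  have hcomp := hunit.comp (constPresheaf_germ_bijective M x)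
  exact (congrArg Function.Bijective (funext fun m =>
    TopCat.Presheaf.stalkFunctor_map_germ_apply ⊤ x (Opens.mem_top x) _ m)).mp hcomp

theorem exists_hom_constSheaf {F : Sh k X} {M : ModuleCat.{u} k} (φ : M →ₗ[k] Sections F ⊤) :
    ∃ f : constSheaf X M ⟶ F, mapSections f ⊤ ∘ₗ constSections X M = φ := by
  let J := Opens.grothendieckTopology X
  let g : constPresheaf X M ⟶ F.presheaf :=
    { app := fun U => ModuleCat.ofHom (res F le_top ∘ₗ φ)
      naturality := fun U V i => by
        refine ModuleCat.hom_ext (LinearMap.ext fun m => ?_)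
        exact (res_res F i.unop.le le_top (φ m)).symm }
  refine ⟨ObjectProperty.homMk (sheafifyLift J g F.property), LinearMap.ext fun m => ?_⟩
  exact (congrArg (fun f => (f.app (op ⊤)).hom m) (toSheafify_sheafifyLift J g F.property)).trans
    (res_self F le_top (φ m))

theorem nonempty_iso_constSheaf_iff (F : Sh k X) (M : ModuleCat.{u} k) :
    Nonempty (F ≅ constSheaf X M) ↔
      ∃ φ : M →ₗ[k] Sections F ⊤, ∀ x, Function.Bijective (germ F (Opens.mem_top x) ∘ₗ φ) := by
  have hmap : ∀ (f : constSheaf X M ⟶ F) x,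
      mapStalk f x ∘ (germ (constSheaf X M) (Opens.mem_top x) ∘ₗ constSections X M) =
        (germ F (Opens.mem_top x) ∘ₗ mapSections f ⊤ ∘ₗ constSections X M :) :=
    fun f x => funext fun m => mapStalk_germ f (Opens.mem_top x) (constSections X M m)
  constructor
  · rintro ⟨i⟩
    refine ⟨mapSections i.inv ⊤ ∘ₗ constSections X M, fun x => ?_⟩
    rw [← hmap]
    exact (mapStalk_bijective i.inv x).comp (germ_comp_constSections_bijective M x)
  · rintro ⟨φ, hφ⟩
    obtain ⟨f, rfl⟩ := exists_hom_constSheaf φ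
    have hf : IsIso f := isIso_of_mapStalk_bijective f fun x =>
      (Function.Bijective.of_comp_iff _ (germ_comp_constSections_bijective M x)).1
        (hmap f x ▸ hφ x)
    exact ⟨(asIso f).symm⟩

theorem IsConstantOfFiniteRank.finite_stalk {F : Sh k X} (hF : IsConstantOfFiniteRank F) (x : X) :
    Module.Finite k (Stalk F x) := by
  obtain ⟨M, hM, hiso⟩ := hF
  obtain ⟨φ, hφ⟩ := (nonempty_iso_constSheaf_iff F M).1 hiso
  exact Module.Finite.of_surjective _ (hφ x).2

theorem IsConstantOfFiniteRank.of_iso {F G : Sh k X} (hF : IsConstantOfFiniteRank F) (i : F ≅ G) :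
    IsConstantOfFiniteRank G := by
  obtain ⟨M, hM, ⟨j⟩⟩ := hF
  exact ⟨M, hM, ⟨i.symm ≪≫ j⟩⟩

end Constant

/-! ### Restriction to open subsets -/

section Restrict

/-- The stalk of the restriction `F|_Z` at a point of `Z` is the stalk of `F`. -/
def stalkRestrictIso (F : Sh k X) (Z : Set X) (x : Z) : Stalk (restrict F Z) x ≅ Stalk F x.1 :=
  let S := TopCat.Presheaf.stalkFunctor (ModuleCat.{u} k) (X := TopCat.of Z) x
  let P := (TopCat.Presheaf.pullback (ModuleCat.{u} k) (incl Z)).obj F.presheaf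
  have := TopCat.Presheaf.stalkFunctor_map_unit_toSheafify_isIso x (ModuleCat.{u} k) P
  let sheafifyStalkIso := asIso (S.map (toSheafify (Opens.grothendieckTopology (TopCat.of Z)) P))
  (TopCat.Sheaf.forget (ModuleCat.{u} k) (TopCat.of Z) ⋙ S).mapIso
      ((TopCat.Sheaf.pullbackIso (ModuleCat.{u} k) (incl Z)).app F) ≪≫
    sheafifyStalkIso.symm ≪≫
    (TopCat.Presheaf.stalkPullbackIso (ModuleCat.{u} k) (incl Z) F.presheaf x).symm

theorem finite_stalk_of_isConstant_restrict {F : Sh k X} {Z : Set X}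
    (hF : IsConstantOfFiniteRank (restrict F Z)) {x : X} (hx : x ∈ Z) :
    Module.Finite k (Stalk F x) :=
  have := hF.finite_stalk ⟨x, hx⟩
  Module.Finite.equiv (stalkRestrictIso F Z ⟨x, hx⟩).toLinearEquiv

theorem isOpenEmbedding_incl (s : Opens X) : IsOpenEmbedding (incl (s : Set X)) :=
  s.isOpen.isOpenEmbedding_subtypeVal

/-- The restriction of a sheaf to an open subset, whose sections are sections of the sheaf. -/
abbrev openRestrict (F : Sh k X) (s : Opens X) : Sh k (TopCat.of s) :=
  ((isOpenEmbedding_incl s).sheafPullback (ModuleCat.{u} k)).obj F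

theorem isOpenEmbedding_incl_functor_obj_top (s : Opens X) :
    (isOpenEmbedding_incl s).functor.obj ⊤ = s := by
  ext x
  simp [incl]

theorem bijective_germ_openRestrict_comp_iff (F : Sh k X) (s : Opens X) {M : ModuleCat.{u} k}
    (φ : M →ₗ[k] Sections (openRestrict F s) ⊤) {U : Opens X}
    (hU : (isOpenEmbedding_incl s).functor.obj ⊤ = U) (x : s) (hx : x.1 ∈ U) :
    Function.Bijective (germ (openRestrict F s) (Opens.mem_top x) ∘ₗ φ) ↔
      Function.Bijective (germ F hx ∘ₗ res F hU.ge ∘ₗ φ) := by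
  let i := AlgebraicGeometry.PresheafedSpace.restrictStalkIso ⟨X, F.presheaf⟩
    (isOpenEmbedding_incl s) x
  have hgerm : ∀ m, i.hom (germ (openRestrict F s) (Opens.mem_top x) (φ m)) =
      germ F hx (res F hU.ge (φ m)) := fun m =>
    (AlgebraicGeometry.PresheafedSpace.restrictStalkIso_hom_eq_germ_apply ⟨X, F.presheaf⟩
      (isOpenEmbedding_incl s) ⊤ x trivial (φ m)).trans (germ_res F hU.ge hx _).symm
  have hi : Function.Bijective i.hom := (ConcreteCategory.isIso_iff_bijective i.hom).1 inferInstance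
  exact (Function.Bijective.of_comp_iff' hi _).symm.trans (iff_of_eq (congrArg _ (funext hgerm)))

theorem isConstant_restrict_iff (F : Sh k X) (s : Opens X) :
    IsConstantOfFiniteRank (restrict F (s : Set X)) ↔
      ∃ (M : ModuleCat.{u} k) (φ : M →ₗ[k] Sections F s), Module.Finite k M ∧
        ∀ x (hx : x ∈ s), Function.Bijective (germ F hx ∘ₗ φ) := by
  have i : restrict F (s : Set X) ≅ openRestrict F s :=
    ((isOpenEmbedding_incl s).sheafPullbackIso (ModuleCat.{u} k)).app F
  have htop := isOpenEmbedding_incl_functor_obj_top s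
  constructor
  · intro h
    obtain ⟨M, hM, hiso⟩ := h.of_iso i
    obtain ⟨φ, hφ⟩ := (nonempty_iso_constSheaf_iff _ M).1 hiso
    exact ⟨M, res F htop.ge ∘ₗ φ, hM, fun x hx =>
      (bijective_germ_openRestrict_comp_iff F s φ htop ⟨x, hx⟩ hx).1 (hφ ⟨x, hx⟩)⟩
  · rintro ⟨M, φ, hM, hφ⟩
    refine IsConstantOfFiniteRank.of_iso ⟨M, hM, (nonempty_iso_constSheaf_iff _ M).2
      ⟨res F htop.le ∘ₗ φ, fun x => ?_⟩⟩ i.symm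
    refine (bijective_germ_openRestrict_comp_iff F s _ htop x x.2).2 ?_
    exact (congrArg Function.Bijective (funext fun m => congrArg (germ F x.2)
      ((res_res F htop.ge htop.le (φ m)).trans (res_self F le_rfl (φ m))))).mpr (hφ x.1 x.2)

theorem isConstant_restrict_of_germ_bijective (F : Sh k X) (U : Opens X)
    (hfin : Module.Finite k (Sections F U))
    (hbij : ∀ x (hx : x ∈ U), Function.Bijective (germ F hx)) :
    IsConstantOfFiniteRank (restrict F (U : Set X)) :=
  (isConstant_restrict_iff F U).2 ⟨Sections F U, LinearMap.id, hfin, hbij⟩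

theorem germ_bijective_of_isConstant_restrict {F : Sh k X} {s U : Opens X}
    (hF : IsConstantOfFiniteRank (restrict F (s : Set X))) (hUs : U ≤ s)
    (hU : IsPreconnected (U : Set X)) {x : X} (hx : x ∈ U) : Function.Bijective (germ F hx) := by
  obtain ⟨M, φ, -, hφ⟩ := (isConstant_restrict_iff F s).1 hF
  refine ⟨(injective_iff_map_eq_zero _).2 fun σ hσ => ?_, fun v => ?_⟩
  · choose value hvalue using fun y : U => (hφ y.1 (hUs y.2)).2 (germ F y.2 σ)
    have hlocal : IsLocallyConstant value := by
      refine (IsLocallyConstant.iff_eventually_eq value).2 fun y => ?_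
      obtain ⟨W, hyW, hWs, hWU, hres⟩ := exists_res_eq_of_germ_eq F (hUs y.2) y.2 (hvalue y)
      filter_upwards [(W.isOpen.preimage continuous_subtype_val).mem_nhds hyW] with z hz
      refine (hφ z.1 (hUs z.2)).1 ((hvalue z).trans ?_)
      exact (germ_res F hWU hz σ).symm.trans
        ((congrArg (germ F hz) hres.symm).trans (germ_res F hWs hz _))
    have : PreconnectedSpace U := Subtype.preconnectedSpace hU
    have hzero : value ⟨x, hx⟩ = 0 :=
      (hφ x (hUs hx)).1 ((hvalue ⟨x, hx⟩).trans (hσ.trans (map_zero _).symm))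
    refine section_ext F fun y hy => ?_
    rw [← hvalue ⟨y, hy⟩, hlocal.apply_eq_of_preconnectedSpace ⟨y, hy⟩ ⟨x, hx⟩, hzero, map_zero,
      map_zero]
  · obtain ⟨m, rfl⟩ := (hφ x (hUs hx)).2 v
    exact ⟨res F hUs (φ m), germ_res F hUs hx (φ m)⟩

end Restrict

end

/-! ### Arcs on the circle -/

section Arc

/-- The quotient map `e`, as a function on `ℝ`. -/
def toCircle (c : ℝ) : circle.{u} := e (ULift.up c)

theorem toCircle_eq_toCircle_iff {c c' : ℝ} :
    toCircle.{u} c = toCircle c' ↔ ∃ j : ℤ, c' = c + 2 * Real.pi * j := by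
  have hcoe : toCircle.{u} c = toCircle c' ↔ (c : AddCircle (2 * Real.pi)) = c' := ULift.up_inj
  rw [hcoe, eq_comm, ← sub_eq_zero, ← AddCircle.coe_sub, AddCircle.coe_eq_zero_iff]
  refine exists_congr fun j => ?_
  rw [zsmul_eq_mul]
  constructor <;> intro h <;> linarith

@[simp] theorem toCircle_add (c : ℝ) (j : ℤ) :
    toCircle.{u} (c + 2 * Real.pi * j) = toCircle c :=
  (toCircle_eq_toCircle_iff.2 ⟨j, rfl⟩).symm

theorem toCircle_add_two_pi (c : ℝ) : toCircle.{u} (c + 2 * Real.pi) = toCircle c := by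
  simpa using toCircle_add.{u} c 1

theorem continuous_toCircle : Continuous toCircle.{u} :=
  continuous_uliftUp.comp (AddCircle.continuous_mk' (2 * Real.pi))

theorem isOpenMap_toCircle : IsOpenMap toCircle.{u} :=
  Homeomorph.ulift.symm.isOpenMap.comp QuotientAddGroup.isOpenMap_coe

theorem toCircle_surjective : Function.Surjective toCircle.{u} := by
  rintro ⟨x⟩
  obtain ⟨c, rfl⟩ := QuotientAddGroup.mk_surjective x
  exact ⟨c, rfl⟩

instance compactSpace_circle : CompactSpace circle.{u} := by
  have : Fact (0 < 2 * Real.pi) := ⟨Real.two_pi_pos⟩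
  exact Homeomorph.ulift.symm.compactSpace

theorem eq_of_toCircle_eq {α c c' : ℝ} (hc : c ∈ Set.Ioo α (α + 2 * Real.pi))
    (hc' : c' ∈ Set.Ioo α (α + 2 * Real.pi)) (h : toCircle.{u} c = toCircle c') : c = c' := by
  have : Fact (0 < 2 * Real.pi) := ⟨Real.two_pi_pos⟩
  exact (AddCircle.coe_eq_coe_iff_of_mem_Ico (Set.Ioo_subset_Ico_self hc)
    (Set.Ioo_subset_Ico_self hc')).1 (ULift.up_inj.1 h)

theorem eventually_toCircle_mem {U : Opens circle.{u}} {c : ℝ} (h : toCircle c ∈ U) :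
    ∀ᶠ c' in 𝓝 c, toCircle c' ∈ U :=
  continuous_toCircle.continuousAt.eventually (U.isOpen.mem_nhds h)

theorem finite_toCircle_preimage_inter_Icc {P : Set circle.{u}} (hP : P.Finite) (a b : ℝ) :
    (toCircle ⁻¹' P ∩ Set.Icc a b).Finite := by
  have hpi := Real.two_pi_pos
  rw [← Set.biUnion_preimage_singleton, Set.iUnion₂_inter]
  refine hP.biUnion fun x _ => ?_
  obtain ⟨c, rfl⟩ := toCircle_surjective x
  refine ((Set.finite_Icc ⌈(a - c) / (2 * Real.pi)⌉ ⌊(b - c) / (2 * Real.pi)⌋).image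
    fun j : ℤ => c + 2 * Real.pi * j).subset ?_
  rintro d ⟨hd, had, hdb⟩
  obtain ⟨j, rfl⟩ := toCircle_eq_toCircle_iff.1 (Eq.symm hd)
  refine ⟨j, ⟨?_, ?_⟩, rfl⟩
  · rw [Int.ceil_le, div_le_iff₀ hpi]
    linarith
  · rw [Int.le_floor, le_div_iff₀ hpi]
    linarith

/-- The open arc that is the image of the open interval `(α, β)`. -/
def arc (α β : ℝ) : Opens circle.{u} := ⟨toCircle '' Set.Ioo α β, isOpenMap_toCircle _ isOpen_Ioo⟩

theorem toCircle_mem_arc {α β c : ℝ} (hα : α < c) (hβ : c < β) : toCircle.{u} c ∈ arc α β :=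
  ⟨c, ⟨hα, hβ⟩, rfl⟩

theorem arc_mono {α β α' β' : ℝ} (hα : α' ≤ α) (hβ : β ≤ β') : arc.{u} α β ≤ arc α' β' :=
  Set.image_mono (Set.Ioo_subset_Ioo hα hβ)

theorem isPreconnected_arc (α β : ℝ) : IsPreconnected (arc.{u} α β : Set circle.{u}) :=
  isPreconnected_Ioo.image _ continuous_toCircle.continuousOn

theorem arc_add (α β : ℝ) (j : ℤ) :
    arc.{u} (α + 2 * Real.pi * j) (β + 2 * Real.pi * j) = arc α β := by
  refine Opens.ext ?_
  change toCircle '' _ = toCircle '' _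
  rw [← Set.image_add_const_Ioo, Set.image_image]
  exact Set.image_congr fun c _ => toCircle_add c j

theorem arc_inf_arc {γ α β α' β' : ℝ} (hα : γ ≤ α) (hβ : β ≤ γ + 2 * Real.pi) (hα' : γ ≤ α')
    (hβ' : β' ≤ γ + 2 * Real.pi) : arc.{u} α β ⊓ arc α' β' = arc (max α α') (min β β') := by
  refine Opens.ext ?_
  change toCircle '' _ ∩ toCircle '' _ = toCircle '' _
  rw [← Set.Ioo_inter_Ioo]
  refine (Set.InjOn.image_inter (u := Set.Ioo γ (γ + 2 * Real.pi))
    (fun c hc c' hc' h => eq_of_toCircle_eq hc hc' h) ?_ ?_).symm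
  · exact Set.Ioo_subset_Ioo hα hβ
  · exact Set.Ioo_subset_Ioo hα' hβ'

theorem arc_sup_arc {α β α' β' : ℝ} (h : α' < β) (h' : α < β') :
    arc.{u} α β ⊔ arc α' β' = arc (min α α') (max β β') := by
  refine Opens.ext ?_
  change toCircle '' _ ∪ toCircle '' _ = toCircle '' _
  rw [← Set.image_union, Set.Ioo_union_Ioo' h h']

end Arc

/-! ### Periodic grids on the line -/

theorem exists_strictMono_range_eq {α : Type*} [LinearOrder α] {D : Set α}
    (hfin : ∀ a b, (D ∩ Set.Icc a b).Finite) (hne : D.Nonempty) (hmax : ∀ c ∈ D, ∃ d ∈ D, c < d)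
    (hmin : ∀ c ∈ D, ∃ d ∈ D, d < c) : ∃ θ : ℤ → α, StrictMono θ ∧ Set.range θ = D := by
  let _ : LocallyFiniteOrder D := LocallyFiniteOrder.ofFiniteIcc fun a b =>
    ((hfin a b).preimage Subtype.val_injective.injOn).subset fun c hc => ⟨c.2, hc⟩
  have _ : Nonempty D := hne.to_subtype
  have _ : NoMaxOrder D := ⟨fun ⟨c, hc⟩ => let ⟨d, hd, h⟩ := hmax c hc; ⟨⟨d, hd⟩, h⟩⟩
  have _ : NoMinOrder D := ⟨fun ⟨c, hc⟩ => let ⟨d, hd, h⟩ := hmin c hc; ⟨⟨d, hd⟩, h⟩⟩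
  let _ : SuccOrder D := LinearLocallyFiniteOrder.succOrder D
  let _ : PredOrder D := LinearLocallyFiniteOrder.predOrder D
  let enum : ℤ ≃o D := orderIsoIntOfLinearSuccPredArch.symm
  refine ⟨Subtype.val ∘ enum, (Subtype.strictMono_coe _).comp enum.strictMono, ?_⟩
  rw [enum.surjective.range_comp, Subtype.range_coe]

theorem orderIso_int_apply (s : ℤ ≃o ℤ) (i : ℤ) : s i = i + s 0 := by
  let f : AddConstMap ℤ ℤ 1 1 := ⟨s, fun i => s.map_succ i⟩
  exact (congrArg s (zero_add i).symm).trans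
    ((AddConstMapClass.map_add_int f 0 i).trans (add_comm _ _))

theorem exists_forall_apply_add_eq {θ : ℤ → ℝ} (hθ : StrictMono θ) {T : ℝ} (hT : 0 < T)
    (hadd : ∀ c, c ∈ Set.range θ ↔ c + T ∈ Set.range θ) :
    ∃ N : ℤ, 0 < N ∧ ∀ i, θ (i + N) = θ i + T := by
  choose s hs using fun i => (hadd (θ i)).1 ⟨i, rfl⟩
  have hmono : StrictMono s := fun i j hij => by
    rw [← hθ.lt_iff_lt, hs, hs]
    linarith [hθ hij]
  have hsurj : Function.Surjective s := fun j => by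
    obtain ⟨i, hi⟩ := (hadd (θ j - T)).2 ⟨j, (sub_add_cancel _ _).symm⟩
    exact ⟨i, hθ.injective (by rw [hs, hi, sub_add_cancel])⟩
  refine ⟨s 0, hθ.lt_iff_lt.1 (by linarith [hs 0]), fun i => ?_⟩
  rw [← hs i]
  exact congrArg θ (orderIso_int_apply (hmono.orderIsoOfSurjective s hsurj) i).symm

/-- A periodic subdivision of the line. The points with even index are the special points, those
with odd index separate adjacent special points. -/
structure Grid where
  /-- the subdivision points -/
  pt : ℤ → ℝ
  /-- the number of subdivision points in an interval of length `2π` -/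
  period : ℤ
  pt_lt : ∀ n, pt n < pt (n + 1)
  period_pos : 0 < period
  even_period : Even period
  pt_add_period : ∀ n, pt (n + period) = pt n + 2 * Real.pi
  pt_add_two_le : ∀ n, pt (n + 2) ≤ pt n + Real.pi

namespace Grid

variable (Q : Grid)

theorem strictMono_pt : StrictMono Q.pt := strictMono_int_of_lt_succ Q.pt_lt

theorem pt_add_three_le (n : ℤ) : Q.pt (n + 3) ≤ Q.pt n + 2 * Real.pi := by
  linarith [Q.strictMono_pt (show n + 3 < n + 2 + 2 by omega), Q.pt_add_two_le n,
    Q.pt_add_two_le (n + 2)]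

theorem pt_add_period_mul (n j : ℤ) : Q.pt (n + Q.period * j) = Q.pt n + 2 * Real.pi * j := by
  let f : AddConstMap ℤ ℝ Q.period (2 * Real.pi) := ⟨Q.pt, Q.pt_add_period⟩
  simpa [mul_comm, f] using AddConstMapClass.map_add_zsmul f n j

theorem exists_lt_pt (c : ℝ) : ∃ j, c < Q.pt (2 * j) := by
  obtain ⟨j, hj⟩ := exists_int_gt ((c - Q.pt 0) / (2 * Real.pi))
  rw [div_lt_iff₀ Real.two_pi_pos] at hj
  obtain ⟨N, hN⟩ := Q.even_period
  refine ⟨N * j, ?_⟩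
  rw [show 2 * (N * j) = 0 + Q.period * j by rw [hN]; ring, pt_add_period_mul]
  linarith

theorem exists_pt_le (c : ℝ) : ∃ j, Q.pt (2 * j) ≤ c := by
  obtain ⟨j, hj⟩ := exists_int_lt ((c - Q.pt 0) / (2 * Real.pi))
  rw [lt_div_iff₀ Real.two_pi_pos] at hj
  obtain ⟨N, hN⟩ := Q.even_period
  refine ⟨N * j, ?_⟩
  rw [show 2 * (N * j) = 0 + Q.period * j by rw [hN]; ring, pt_add_period_mul]
  linarith

/-- The strata of the line defined by the grid: the point with index `n` for `n` even, the open
interval between the points with indices `n - 1` and `n + 1` for `n` odd. -/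
def cell (n : ℤ) : Set ℝ := {c | Q.pt (n - 1) < c ∧ c < Q.pt (n + 1) ∧ (Even n → c = Q.pt n)}

theorem pt_mem_cell (n : ℤ) : Q.pt n ∈ Q.cell n :=
  ⟨Q.strictMono_pt (by omega), Q.strictMono_pt (by omega), fun _ => rfl⟩

theorem mem_cell_of_odd {n : ℤ} (hn : Odd n) {c : ℝ} (hl : Q.pt (n - 1) < c)
    (hr : c < Q.pt (n + 1)) : c ∈ Q.cell n :=
  ⟨hl, hr, fun h => absurd hn (Int.not_odd_iff_even.2 h)⟩

theorem le_of_mem_cell {m n : ℤ} {c d : ℝ} (hc : c ∈ Q.cell m) (hd : d ∈ Q.cell n) (hcd : c ≤ d) :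
    m ≤ n := by
  by_contra! hnm
  have hpt : Q.pt (m - 1) < Q.pt (n + 1) := hc.1.trans_le (hcd.trans hd.2.1.le)
  obtain rfl : m = n + 1 := by have := Q.strictMono_pt.lt_iff_lt.1 hpt; omega
  have hnc : Q.pt n < c := by simpa using hc.1
  rcases Int.even_or_odd n with hn | hn
  · exact absurd (hd.2.2 hn) (hnc.trans_le hcd).ne'
  · exact absurd (hc.2.2 hn.add_one) (hcd.trans_lt hd.2.1).ne

theorem exists_mem_cell (c : ℝ) : ∃ n, c ∈ Q.cell n := by
  obtain ⟨b, hb⟩ := Q.exists_lt_pt c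
  obtain ⟨n, hn, hmax⟩ := Int.exists_greatest_of_bdd (P := fun n => Q.pt (2 * n) ≤ c)
    ⟨b, fun z hz => by have := Q.strictMono_pt.lt_iff_lt.1 (hz.trans_lt hb); omega⟩
    (Q.exists_pt_le c)
  have hc : c < Q.pt (2 * n + 2) := by
    by_contra! h
    have := hmax (n + 1) (by rwa [mul_add, mul_one])
    omega
  rcases hn.eq_or_lt with rfl | hn
  · exact ⟨2 * n, Q.pt_mem_cell _⟩
  · exact ⟨2 * n + 1, Q.mem_cell_of_odd (odd_two_mul_add_one n) (by rwa [add_sub_cancel_right])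
      (by rwa [add_assoc])⟩

/-- The index of the cell that contains `c`. -/
def idx (c : ℝ) : ℤ := (Q.exists_mem_cell c).choose

theorem mem_cell_idx (c : ℝ) : c ∈ Q.cell (Q.idx c) := (Q.exists_mem_cell c).choose_spec

theorem idx_eq_iff {c : ℝ} {n : ℤ} : Q.idx c = n ↔ c ∈ Q.cell n := by
  constructor
  · rintro rfl
    exact Q.mem_cell_idx c
  · exact fun h => le_antisymm (Q.le_of_mem_cell (Q.mem_cell_idx c) h le_rfl)
      (Q.le_of_mem_cell h (Q.mem_cell_idx c) le_rfl)

theorem monotone_idx : Monotone Q.idx := fun c d h =>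
  Q.le_of_mem_cell (Q.mem_cell_idx c) (Q.mem_cell_idx d) h

theorem idx_pt (n : ℤ) : Q.idx (Q.pt n) = n := Q.idx_eq_iff.2 (Q.pt_mem_cell n)

theorem idx_add (c : ℝ) (j : ℤ) : Q.idx (c + 2 * Real.pi * j) = Q.idx c + Q.period * j := by
  rw [idx_eq_iff]
  obtain ⟨hl, hr, hpt⟩ := Q.mem_cell_idx c
  refine ⟨?_, ?_, fun heven => ?_⟩
  · rw [add_sub_right_comm, pt_add_period_mul]
    linarith
  · rw [add_right_comm, pt_add_period_mul]
    linarith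
  · rw [pt_add_period_mul, ← hpt ((Int.even_add.1 heven).2 (Q.even_period.mul_right j))]

/-- The grid whose special points are enumerated by `θ`, separated by their midpoints. -/
def ofStrictMono {θ : ℤ → ℝ} (hθ : StrictMono θ) {N : ℤ} (hN : 0 < N)
    (hadd : ∀ i, θ (i + N) = θ i + Real.pi) : Grid where
  pt n := (θ (n / 2) + θ ((n + 1) / 2)) / 2
  period := 4 * N
  pt_lt n := by
    have hlt := hθ (show n / 2 < (n + 1 + 1) / 2 by omega)
    linarith
  period_pos := by omega
  even_period := ⟨2 * N, by ring⟩
  pt_add_period n := by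
    rw [show (n + 4 * N) / 2 = n / 2 + N + N by omega,
      show (n + 4 * N + 1) / 2 = (n + 1) / 2 + N + N by omega]
    simp only [hadd]
    ring
  pt_add_two_le n := by
    have hl := hθ.monotone (show (n + 2) / 2 ≤ n / 2 + N by omega)
    have hr := hθ.monotone (show (n + 2 + 1) / 2 ≤ (n + 1) / 2 + N by omega)
    rw [hadd] at hl hr
    linarith

theorem ofStrictMono_pt_two_mul {θ : ℤ → ℝ} (hθ : StrictMono θ) {N : ℤ} (hN : 0 < N)
    (hadd : ∀ i, θ (i + N) = θ i + Real.pi) (i : ℤ) :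
    (ofStrictMono hθ hN hadd).pt (2 * i) = θ i := by
  simp only [ofStrictMono]
  rw [show 2 * i / 2 = i by omega, show (2 * i + 1) / 2 = i by omega, add_self_div_two]

end Grid

theorem exists_grid_of_finite {P : Set circle.{u}} (hP : P.Finite) :
    ∃ Q : Grid, ∀ c, toCircle c ∈ P → Even (Q.idx c) := by
  -- Adding a point and all antipodes makes the set of special points `π`-periodic, so that
  -- adjacent special points are at distance at most `π`.
  let D : Set ℝ := {c | toCircle.{u} c ∈ insert (toCircle 0) P} ∪
    {c | toCircle.{u} (c + Real.pi) ∈ insert (toCircle 0) P}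
  have hP' := hP.insert (toCircle.{u} 0)
  have hfin : ∀ a b, (D ∩ Set.Icc a b).Finite := fun a b => by
    have hleft := finite_toCircle_preimage_inter_Icc hP' a b
    have hright := (finite_toCircle_preimage_inter_Icc hP' (a + Real.pi) (b + Real.pi)).preimage
      (add_left_injective Real.pi).injOn
    refine (hleft.union hright).subset ?_
    rintro c ⟨hc | hc, hac, hcb⟩
    · exact Or.inl ⟨hc, hac, hcb⟩
    · exact Or.inr ⟨hc, by linarith, by linarith⟩
  have hadd : ∀ c, c ∈ D ↔ c + Real.pi ∈ D := fun c => by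
    have htwo := toCircle_add_two_pi.{u} c
    rw [two_mul, ← add_assoc] at htwo
    simp only [D, Set.mem_union, Set.mem_ofPred_eq, htwo]
    exact or_comm
  have hpi := Real.pi_pos
  obtain ⟨θ, hθ, hrange⟩ := exists_strictMono_range_eq hfin ⟨0, Or.inl (Set.mem_insert _ _)⟩
    (fun c hc => ⟨c + Real.pi, (hadd c).1 hc, by linarith⟩)
    (fun c hc => ⟨c - Real.pi, (hadd _).2 (by rwa [sub_add_cancel]), by linarith⟩)
  obtain ⟨N, hN, hper⟩ := exists_forall_apply_add_eq hθ hpi (by rwa [hrange])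
  refine ⟨Grid.ofStrictMono hθ hN hper, fun c hc => ?_⟩
  obtain ⟨i, rfl⟩ : c ∈ Set.range θ := hrange ▸ Or.inl (Set.mem_insert_of_mem _ hc)
  rw [← Grid.ofStrictMono_pt_two_mul hθ hN hper i, Grid.idx_pt]
  exact even_two_mul i

variable {k : Type u} [Field k]

/-! ### Bijectivity of restriction maps and germs -/

section Bijective

variable {X : TopCat.{u}} {F : Sh k X}

theorem res_bijective_of_germ_bijective {U V : Opens X} (h : U ≤ V) {x : X} (hx : x ∈ U)
    (hU : Function.Bijective (germ F hx)) (hV : Function.Bijective (germ F (h hx))) :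
    Function.Bijective (res F h) :=
  (Function.Bijective.of_comp_iff' hU _).1
    ((congrArg Function.Bijective (funext (germ_res F h hx))).mpr hV)

theorem germ_bijective_of_res_bijective {U : Opens X} {x : X} (hx : x ∈ U)
    (h : ∀ W, x ∈ W → ∃ (V : Opens X) (_ : V ≤ W) (_ : x ∈ V) (hVU : V ≤ U),
      Function.Bijective (res F hVU)) : Function.Bijective (germ F hx) := by
  refine ⟨(injective_iff_map_eq_zero _).2 fun σ hσ => ?_, fun v => ?_⟩
  · obtain ⟨W, hxW, hWU, hWU', hres⟩ :=
      exists_res_eq_of_germ_eq F (t := 0) hx hx (hσ.trans (map_zero _).symm)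
    obtain ⟨V, hVW, -, hVU, hbij⟩ := h W hxW
    refine hbij.1 ?_
    rw [← res_res F hVW hWU σ, hres, map_zero, map_zero, map_zero]
  · obtain ⟨W, -, hxW, τ, rfl⟩ := exists_germ_eq F v hx
    obtain ⟨V, hVW, hxV, hVU, hbij⟩ := h W hxW
    obtain ⟨σ, hσ⟩ := hbij.2 (res F hVW τ)
    exact ⟨σ, by rw [← germ_res F hVU hxV, hσ, germ_res]⟩

theorem res_bijective_of_inf_of_sup {A B U V : Opens X} (hA : U ⊓ V = A) (hB : U ⊔ V = B)
    (hAU : A ≤ U) (hVB : V ≤ B) (h : Function.Bijective (res F hAU)) :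
    Function.Bijective (res F hVB) := by
  subst hA hB
  refine ⟨(injective_iff_map_eq_zero _).2 fun σ hσ => ?_, fun t => ?_⟩
  · have hU : res F le_sup_left σ = 0 := h.1 <| by
      rw [res_res, map_zero, ← res_res F inf_le_right hVB, hσ, map_zero]
    refine section_ext F fun x hx => ?_
    rcases hx with hx | hx
    · rw [← germ_res F le_sup_left hx, hU, map_zero, map_zero]
    · rw [← germ_res F hVB hx, hσ, map_zero, map_zero]
  · obtain ⟨s, hs⟩ := h.2 (res F inf_le_right t)
    obtain ⟨σ, -, hσ⟩ := exists_section_sup F s t hs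
    exact ⟨σ, hσ⟩

end Bijective

theorem germ_arc_bijective_of_sides {F : Sh k circle.{u}} {α β c : ℝ} (hα : α < c) (hβ : c < β)
    (hlen : β ≤ α + 2 * Real.pi)
    (hleft : ∀ α' (h : α ≤ α'), α' < c →
      Function.Bijective (res F (arc_mono h le_rfl : arc α' c ≤ arc α c)))
    (hright : ∀ β' (h : β' ≤ β), c < β' →
      Function.Bijective (res F (arc_mono le_rfl h : arc c β' ≤ arc c β))) :
    Function.Bijective (germ F (toCircle_mem_arc hα hβ)) := by
  refine germ_bijective_of_res_bijective _ fun W hcW => ?_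
  obtain ⟨α', β', ⟨hα', hβ'⟩, hW⟩ := (mem_nhds_iff_exists_Ioo_subset.1
    ((eventually_toCircle_mem hcW).and (Ioo_mem_nhds hα hβ)))
  have hsub := (Set.Ioo_subset_Ioo_iff (hα'.trans hβ')).1 fun d hd => (hW hd).2
  have hαβ : arc.{u} α' β' ≤ arc α β' := arc_mono hsub.1 le_rfl
  have hβα : arc.{u} α β' ≤ arc α β := arc_mono le_rfl hsub.2
  refine ⟨arc α' β', ?_, toCircle_mem_arc hα' hβ', hαβ.trans hβα, ?_⟩
  · rintro _ ⟨d, hd, rfl⟩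
    exact (hW hd).1
  have houter : Function.Bijective (res F hβα) := by
    refine res_bijective_of_inf_of_sup (U := arc c β) (A := arc c β') ?_ ?_
      (arc_mono le_rfl hsub.2) hβα (hright β' hsub.2 hβ')
    · rw [arc_inf_arc (γ := α) hα.le hlen le_rfl (hsub.2.trans hlen), max_eq_left hα.le,
        min_eq_right hsub.2]
    · rw [arc_sup_arc (hα.trans hβ) hβ', min_eq_right hα.le, max_eq_left hsub.2]
  have hinner : Function.Bijective (res F hαβ) := by
    refine res_bijective_of_inf_of_sup (U := arc α c) (A := arc α' c) ?_ ?_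
      (arc_mono hsub.1 le_rfl) hαβ (hleft α' hsub.1 hα')
    · rw [arc_inf_arc (γ := α) le_rfl (hβ.le.trans hlen) hsub.1 (hsub.2.trans hlen),
        max_eq_right hsub.1, min_eq_left hβ'.le]
    · rw [arc_sup_arc hα' (hα.trans hβ'), min_eq_left hsub.1, max_eq_right hβ'.le]
  exact (congrArg Function.Bijective (funext (res_res F hαβ hβα))).mp (hinner.comp houter)

/-! ### Sheaves adapted to a grid -/

namespace Grid

variable (Q : Grid)

/-- The open arc around the grid point with index `n`, up to the neighbouring grid points. -/
def star (n : ℤ) : Opens circle.{u} := arc (Q.pt (n - 1)) (Q.pt (n + 1))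

theorem star_add (n j : ℤ) : Q.star.{u} (n + Q.period * j) = Q.star n := by
  rw [star, star, add_sub_right_comm, add_right_comm, pt_add_period_mul, pt_add_period_mul, arc_add]

theorem star_inf_star_succ (n : ℤ) :
    Q.star.{u} n ⊓ Q.star (n + 1) = arc (Q.pt n) (Q.pt (n + 1)) := by
  have hlen := Q.pt_add_three_le (n - 1)
  rw [show n - 1 + 3 = n + 1 + 1 by ring] at hlen
  have hl := (Q.strictMono_pt (show n - 1 < n by omega)).le
  have hr := (Q.pt_lt (n + 1)).le
  rw [star, star, add_sub_cancel_right, arc_inf_arc le_rfl (hr.trans hlen) hl hlen,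
    max_eq_right hl, min_eq_left hr]

variable {Q} in
theorem toCircle_mem_star {n : ℤ} {c : ℝ} (h : c ∈ Q.cell n) : toCircle.{u} c ∈ Q.star n :=
  toCircle_mem_arc h.1 h.2.1

theorem toCircle_mem_star_left {n : ℤ} {d : ℝ} (hl : Q.pt n < d) (hr : d < Q.pt (n + 1)) :
    toCircle.{u} d ∈ Q.star n :=
  toCircle_mem_arc ((Q.strictMono_pt (by omega)).trans hl) hr

theorem toCircle_mem_star_right {n : ℤ} {d : ℝ} (hl : Q.pt n < d) (hr : d < Q.pt (n + 1)) :
    toCircle.{u} d ∈ Q.star (n + 1) :=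
  toCircle_mem_arc (by simpa using hl) (hr.trans (Q.pt_lt _))

theorem mem_cell_left {n : ℤ} (hn : Odd n) {d : ℝ} (hl : Q.pt n < d) (hr : d < Q.pt (n + 1)) :
    d ∈ Q.cell n :=
  Q.mem_cell_of_odd hn ((Q.strictMono_pt (by omega)).trans hl) hr

theorem mem_cell_right {n : ℤ} (hn : Even n) {d : ℝ} (hl : Q.pt n < d) (hr : d < Q.pt (n + 1)) :
    d ∈ Q.cell (n + 1) :=
  Q.mem_cell_of_odd hn.add_one (by simpa using hl) (hr.trans (Q.pt_lt _))

theorem odd_idx_of_pt_lt {n : ℤ} {d : ℝ} (hl : Q.pt n < d) (hr : d < Q.pt (n + 1)) :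
    Odd (Q.idx d) := by
  rcases Int.even_or_odd n with hn | hn
  · rw [Q.idx_eq_iff.2 (Q.mem_cell_right hn hl hr)]
    exact hn.add_one
  · rwa [Q.idx_eq_iff.2 (Q.mem_cell_left hn hl hr)]

theorem finite_range_star : (Set.range Q.star.{u}).Finite := by
  have hper : Function.Periodic Q.star.{u} Q.period := fun n => by simpa using Q.star_add n 1
  rw [← hper.image_Ioc Q.period_pos 0]
  exact (Set.finite_Ioc _ _).image _

theorem frequently_star {p : Opens circle.{u} → Opens circle.{u} → Prop} {i : ℤ}
    (h : p (Q.star i) (Q.star (i + 1))) :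
    ∃ᶠ i in Filter.atTop, p (Q.star i) (Q.star (i + 1)) := by
  have htendsto : Filter.Tendsto (fun j : ℤ => i + Q.period * j) Filter.atTop Filter.atTop :=
    Filter.tendsto_atTop_add_const_left _ _ (Filter.tendsto_id.const_mul_atTop' Q.period_pos)
  refine htendsto.frequently (Filter.Frequently.of_forall fun j => ?_)
  rwa [add_right_comm, star_add, star_add]

end Grid

/-- A sheaf on the circle is adapted to a grid if its sections over the stars are
finite-dimensional, and its sections over an arc contained in a star are determined by their germ
at the special point if the arc contains one, and at any point otherwise. -/
structure IsAdapted (Q : Grid) (F : Sh k circle.{u}) : Prop where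
  finite_sections : ∀ n, Module.Finite k (Sections F (Q.star n))
  germ_bijective : ∀ {n c α β}, c ∈ Q.cell n → Q.pt (n - 1) ≤ α → β ≤ Q.pt (n + 1) →
    ∀ (hα : α < c) (hβ : c < β), Function.Bijective (germ F (toCircle_mem_arc hα hβ))

theorem IsAdapted.of_retract {Q : Grid} {F G : Sh k circle.{u}} (hF : IsAdapted Q F) {i : G ⟶ F}
    {r : F ⟶ G} (hir : i ≫ r = 𝟙 G) : IsAdapted Q G := by
  have hsections : ∀ U, Function.LeftInverse (mapSections r U) (mapSections i U) := fun U s => by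
    rw [← mapSections_comp, hir, mapSections_id]
  have hstalk : ∀ x, Function.LeftInverse (mapStalk r x) (mapStalk i x) := fun x v => by
    obtain ⟨U, -, hx, s, rfl⟩ := exists_germ_eq G v (Opens.mem_top x)
    rw [mapStalk_germ, mapStalk_germ, hsections]
  refine ⟨fun n => ?_, fun hc hn hn' hα hβ => ?_⟩
  · have := hF.finite_sections n
    exact Module.Finite.of_injective _ (hsections (Q.star n)).injective
  · obtain ⟨hinj, hsurj⟩ := hF.germ_bijective hc hn hn' hα hβ
    refine ⟨fun s t hst => (hsections _).injective (hinj ?_), fun v => ?_⟩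
    · rw [← mapStalk_germ, ← mapStalk_germ, hst]
    · obtain ⟨τ, hτ⟩ := hsurj (mapStalk i _ v)
      exact ⟨mapSections r _ τ, by rw [← mapStalk_germ, hτ, hstalk]⟩

/-! ### Constructible sheaves are adapted to a grid -/

theorem IsStratification.finite {X : Type u} [TopologicalSpace X] [CompactSpace X]
    {S : Set (Set X)} (hS : IsStratification S) : S.Finite := by
  have := hS.locallyFinite.finite_of_compact fun s => (hS.isConnected s.1 s.2).nonempty
  exact Set.finite_coe_iff.1 (Set.finite_univ_iff.1 this)

theorem IsStratification.exists_subset_of_isPreconnected {X : Type u} [TopologicalSpace X]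
    {S : Set (Set X)} (hS : IsStratification S) {A : Set X} (hA : IsPreconnected A)
    (hne : A.Nonempty) (hpoint : ∀ x ∈ A, {x} ∉ S) : ∃ s ∈ S, IsOpen s ∧ A ⊆ s := by
  have hopen : ∀ x ∈ A, ∀ s ∈ S, x ∈ s → IsOpen s := by
    intro x hx s hs hxs
    rcases hS.point_or_open s hs with ⟨y, rfl⟩ | hs'
    · exact absurd (Set.mem_singleton_iff.1 hxs ▸ hs) (hpoint x hx)
    · exact hs'
  obtain ⟨x, hx⟩ := hne
  obtain ⟨s, ⟨hs, hxs⟩, -⟩ := hS.isPartition.2 x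
  have hso := hopen x hx s hs hxs
  refine ⟨s, hs, hso, hA.subset_left_of_subset_union (v := ⋃₀ {t ∈ S | t ≠ s ∧ IsOpen t}) hso
    (isOpen_sUnion fun t ht => ht.2.2) ?_ (fun y hy => ?_) ⟨x, hx, hxs⟩⟩
  · rw [Set.disjoint_sUnion_right]
    exact fun t ht => hS.isPartition.pairwiseDisjoint hs ht.1 ht.2.1.symm
  · obtain ⟨t, ⟨ht, hyt⟩, -⟩ := hS.isPartition.2 y
    by_cases hts : t = s
    · exact Or.inl (hts ▸ hyt)
    · exact Or.inr ⟨t, ⟨ht, hts, hopen y hy t ht hyt⟩, hyt⟩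

theorem germ_arc_bijective_of_odd_idx {Q : Grid} {F : Sh k circle.{u}}
    (hodd : ∀ {α β d : ℝ} (_ : ∀ d ∈ Set.Ioo α β, Odd (Q.idx d)) (hα : α < d) (hβ : d < β),
      Function.Bijective (germ F (toCircle_mem_arc hα hβ)))
    {n : ℤ} {c α β : ℝ} (hc : c ∈ Q.cell n) (hn : Q.pt (n - 1) ≤ α) (hn' : β ≤ Q.pt (n + 1))
    (hα : α < c) (hβ : c < β) : Function.Bijective (germ F (toCircle_mem_arc hα hβ)) := by
  rcases Int.even_or_odd n with heven | h
  · obtain rfl := hc.2.2 heven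
    have hlen : β ≤ α + 2 * Real.pi := by
      have := Q.pt_add_two_le (n - 1)
      rw [show n - 1 + 2 = n + 1 by ring] at this
      linarith [Real.pi_pos]
    have hl : ∀ {α'}, α ≤ α' → ∀ d ∈ Set.Ioo α' (Q.pt n), Odd (Q.idx d) := fun h d hd =>
      Q.odd_idx_of_pt_lt (hn.trans_lt (h.trans_lt hd.1)) (by simpa using hd.2)
    have hr : ∀ {β'}, β' ≤ β → ∀ d ∈ Set.Ioo (Q.pt n) β', Odd (Q.idx d) := fun h d hd =>
      Q.odd_idx_of_pt_lt hd.1 ((hd.2.trans_le h).trans_le hn')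
    refine germ_arc_bijective_of_sides hα hβ hlen (fun α' hα' h => ?_) fun β' hβ' h => ?_
    · obtain ⟨d, hd, hd'⟩ := exists_between h
      exact res_bijective_of_germ_bijective _ (toCircle_mem_arc hd hd') (hodd (hl hα') hd hd')
        (hodd (hl le_rfl) (hα'.trans_lt hd) hd')
    · obtain ⟨d, hd, hd'⟩ := exists_between h
      exact res_bijective_of_germ_bijective _ (toCircle_mem_arc hd hd') (hodd (hr hβ') hd hd')
        (hodd (hr le_rfl) hd (hd'.trans_le hβ'))
  · refine hodd (fun d hd => ?_) hα hβ
    rwa [Q.idx_eq_iff.2 (Q.mem_cell_of_odd h (hn.trans_lt hd.1) (hd.2.trans_le hn'))]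

theorem IsConstructible.exists_isAdapted {F : Sh k circle.{u}} (hF : IsConstructible F) :
    ∃ Q : Grid, IsAdapted Q F := by
  obtain ⟨S, hS, hconst⟩ := hF
  have hfinite : {x : circle.{u} | {x} ∈ S}.Finite :=
    hS.finite.preimage Set.singleton_injective.injOn
  obtain ⟨Q, hQ⟩ := exists_grid_of_finite hfinite
  have hodd : ∀ {α β d : ℝ} (_ : ∀ d ∈ Set.Ioo α β, Odd (Q.idx d)) (hα : α < d) (hβ : d < β),
      Function.Bijective (germ F (toCircle_mem_arc hα hβ)) := by
    intro α β d hno hα hβ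
    obtain ⟨s, hs, hso, hsub⟩ := hS.exists_subset_of_isPreconnected (isPreconnected_arc α β)
      ⟨_, toCircle_mem_arc hα hβ⟩ (by
        rintro _ ⟨d, hd, rfl⟩ hdS
        exact Int.not_even_iff_odd.2 (hno d hd) (hQ d hdS))
    exact germ_bijective_of_isConstant_restrict (s := ⟨s, hso⟩) (hconst s hs) hsub
      (isPreconnected_arc α β) _
  have hgerm : ∀ {n c α β}, c ∈ Q.cell n → Q.pt (n - 1) ≤ α → β ≤ Q.pt (n + 1) →
      ∀ (hα : α < c) (hβ : c < β), Function.Bijective (germ F (toCircle_mem_arc hα hβ)) :=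
    germ_arc_bijective_of_odd_idx hodd
  refine ⟨Q, fun n => ?_, hgerm⟩
  obtain ⟨s, ⟨hs, hxs⟩, -⟩ := hS.isPartition.2 (toCircle.{u} (Q.pt n))
  have := finite_stalk_of_isConstant_restrict (hconst s hs) hxs
  have hc := Q.pt_mem_cell n
  exact Module.Finite.of_injective _ (hgerm hc le_rfl le_rfl hc.1 hc.2.1).1

/-! ### The relations between sections over consecutive stars -/

/-- The linear relation between sections over `U` and over `V` given by agreement on `U ⊓ V`. -/
def agreeingPairs {X : TopCat.{u}} (F : Sh k X) (U V : Opens X) :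
    Submodule k (Sections F U × Sections F V) :=
  LinearMap.eqLocus (res F (inf_le_left : U ⊓ V ≤ U) ∘ₗ LinearMap.fst k _ _)
    (res F (inf_le_right : U ⊓ V ≤ V) ∘ₗ LinearMap.snd k _ _)

/-- The linear relation between sections over two consecutive stars given by agreement on their
intersection. -/
abbrev starRel (Q : Grid) (F : Sh k circle.{u}) (n : ℤ) :
    Submodule k (Sections F (Q.star n) × Sections F (Q.star (n + 1))) :=
  agreeingPairs F (Q.star n) (Q.star (n + 1))

namespace IsAdapted

variable {Q : Grid} {F : Sh k circle.{u}} (hF : IsAdapted Q F) {n : ℤ}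

include hF

theorem germ_star_bijective {c : ℝ} (h : c ∈ Q.cell n) :
    Function.Bijective (germ F (Grid.toCircle_mem_star h)) :=
  hF.germ_bijective h le_rfl le_rfl h.1 h.2.1

theorem mem_starRel {d : ℝ} (hl : Q.pt n < d) (hr : d < Q.pt (n + 1))
    {p : Sections F (Q.star n) × Sections F (Q.star (n + 1))} : p ∈ starRel Q F n ↔
      germ F (Q.toCircle_mem_star_left hl hr) p.1 =
        germ F (Q.toCircle_mem_star_right hl hr) p.2 := by
  have hd : toCircle d ∈ Q.star n ⊓ Q.star (n + 1) := Opens.mem_inf.2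
    ⟨Q.toCircle_mem_star_left hl hr, Q.toCircle_mem_star_right hl hr⟩
  have hinj : ∀ {U} (_ : arc (Q.pt n) (Q.pt (n + 1)) = U) (h : toCircle d ∈ U),
      Function.Injective (germ F h) := by
    rintro _ rfl -
    rcases Int.even_or_odd n with hn | hn
    · exact (hF.germ_bijective (Q.mem_cell_right hn hl hr) (by simp) (Q.pt_lt _).le hl hr).1
    · exact (hF.germ_bijective (Q.mem_cell_left hn hl hr) (Q.strictMono_pt (by omega)).le le_rfl
        hl hr).1
  rw [← germ_res F inf_le_left hd, ← germ_res F inf_le_right hd,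
    (hinj (Q.star_inf_star_succ n).symm hd).eq_iff]
  exact Iff.rfl

theorem exists_mem_starRel_of_even (hn : Even n) (σ : Sections F (Q.star n)) :
    ∃ τ, (σ, τ) ∈ starRel Q F n := by
  obtain ⟨d, hl, hr⟩ := exists_between (Q.pt_lt n)
  obtain ⟨τ, hτ⟩ := (hF.germ_star_bijective (Q.mem_cell_right hn hl hr)).2
    (germ F (Q.toCircle_mem_star_left hl hr) σ)
  exact ⟨τ, (hF.mem_starRel hl hr).2 hτ.symm⟩

theorem right_eq_zero_of_even (hn : Even n) {τ : Sections F (Q.star (n + 1))}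
    (h : (0, τ) ∈ starRel Q F n) : τ = 0 := by
  obtain ⟨d, hl, hr⟩ := exists_between (Q.pt_lt n)
  refine (hF.germ_star_bijective (Q.mem_cell_right hn hl hr)).1 ?_
  exact ((hF.mem_starRel hl hr).1 h).symm.trans (by simp only [map_zero])

theorem exists_mem_starRel_of_odd (hn : Odd n) (τ : Sections F (Q.star (n + 1))) :
    ∃ σ, (σ, τ) ∈ starRel Q F n := by
  obtain ⟨d, hl, hr⟩ := exists_between (Q.pt_lt n)
  obtain ⟨σ, hσ⟩ := (hF.germ_star_bijective (Q.mem_cell_left hn hl hr)).2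
    (germ F (Q.toCircle_mem_star_right hl hr) τ)
  exact ⟨σ, (hF.mem_starRel hl hr).2 hσ⟩

theorem left_eq_zero_of_odd (hn : Odd n) {σ : Sections F (Q.star n)}
    (h : (σ, 0) ∈ starRel Q F n) : σ = 0 := by
  obtain ⟨d, hl, hr⟩ := exists_between (Q.pt_lt n)
  refine (hF.germ_star_bijective (Q.mem_cell_left hn hl hr)).1 ?_
  exact ((hF.mem_starRel hl hr).1 h).trans (by simp only [map_zero])

theorem germ_left_bijective {d : ℝ} (hl : Q.pt n < d) (hr : d < Q.pt (n + 1))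
    (hbij : Function.Bijective (germ F (Q.toCircle_mem_star_right hl hr)))
    (hker : ∀ σ, (σ, 0) ∈ starRel Q F n → σ = 0)
    (hsurj : ∀ τ, ∃ σ, (σ, τ) ∈ starRel Q F n) :
    Function.Bijective (germ F (Q.toCircle_mem_star_left hl hr)) := by
  refine ⟨(injective_iff_map_eq_zero _).2 fun σ hσ =>
    hker σ ((hF.mem_starRel hl hr).2 (hσ.trans (map_zero _).symm)), fun v => ?_⟩
  obtain ⟨τ, rfl⟩ := hbij.2 v
  exact (hsurj τ).imp fun σ hσ => (hF.mem_starRel hl hr).1 hσ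

theorem germ_right_bijective {d : ℝ} (hl : Q.pt n < d) (hr : d < Q.pt (n + 1))
    (hbij : Function.Bijective (germ F (Q.toCircle_mem_star_left hl hr)))
    (hker : ∀ τ, (0, τ) ∈ starRel Q F n → τ = 0)
    (hsurj : ∀ σ, ∃ τ, (σ, τ) ∈ starRel Q F n) :
    Function.Bijective (germ F (Q.toCircle_mem_star_right hl hr)) := by
  refine ⟨(injective_iff_map_eq_zero _).2 fun τ hτ =>
    hker τ ((hF.mem_starRel hl hr).2 (hτ.trans (map_zero _).symm).symm), fun v => ?_⟩
  obtain ⟨σ, rfl⟩ := hbij.2 v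
  exact (hsurj σ).imp fun τ hτ => ((hF.mem_starRel hl hr).1 hτ).symm

theorem germ_star_bijective_of_relImage (hbot : ∀ n, LinRel.relImage (starRel Q F n) ⊥ = ⊥)
    (htop : ∀ n, LinRel.relImage (starRel Q F n) ⊤ = ⊤) {x : circle.{u}} (hx : x ∈ Q.star n) :
    Function.Bijective (germ F hx) := by
  have := hF.finite_sections
  have hker_right : ∀ n (τ : Sections F (Q.star (n + 1))), (0, τ) ∈ starRel Q F n → τ = 0 :=
    fun n τ hτ => (Submodule.eq_bot_iff _).1 (hbot n) τ (LinRel.mem_relImage_bot.2 hτ)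
  have hsurj_right : ∀ n (τ : Sections F (Q.star (n + 1))), ∃ σ, (σ, τ) ∈ starRel Q F n :=
    fun n τ => LinRel.mem_relImage_top.1 ((htop n).symm ▸ Submodule.mem_top)
  have hleft := LinRel.bijective_of_periodic Q.period_pos
    (fun i => by rw [← mul_one Q.period, Q.star_add]) hbot htop
  obtain ⟨d, ⟨hl, hr⟩, rfl⟩ := hx
  rcases Int.even_or_odd n with hn | hn
  · rcases lt_trichotomy d (Q.pt n) with hd | rfl | hd
    · obtain ⟨m, rfl⟩ : ∃ m, m + 1 = n := ⟨n - 1, by ring⟩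
      rw [add_sub_cancel_right] at hl
      have hm : Odd m := by simpa [Int.even_add_one] using hn
      exact hF.germ_right_bijective hl hd (hF.germ_star_bijective (Q.mem_cell_left hm hl hd))
        (hker_right m) (hleft m).2
    · exact hF.germ_star_bijective (Q.pt_mem_cell n)
    · exact hF.germ_left_bijective hd hr (hF.germ_star_bijective (Q.mem_cell_right hn hd hr))
        (hleft n).1 (hsurj_right n)
  · exact hF.germ_star_bijective (Q.mem_cell_of_odd hn hl hr)

theorem isLocallyConstantOfFiniteRank (hbot : ∀ n, LinRel.relImage (starRel Q F n) ⊥ = ⊥)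
    (htop : ∀ n, LinRel.relImage (starRel Q F n) ⊤ = ⊤) : IsLocallyConstantOfFiniteRank F := by
  intro x
  obtain ⟨c, rfl⟩ := toCircle_surjective x
  exact ⟨Q.star (Q.idx c), (Q.star _).isOpen, Grid.toCircle_mem_star (Q.mem_cell_idx c),
    isConstant_restrict_of_germ_bijective F _ (hF.finite_sections _) fun _ hx =>
      hF.germ_star_bijective_of_relImage hbot htop hx⟩

theorem exists_isString_or_isLocallyConstantOfFiniteRank :
    (∃ i n x t, LinRel.IsString (starRel Q F) i n x t) ∨ IsLocallyConstantOfFiniteRank F := by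
  have := hF.finite_sections
  obtain ⟨B, hB⟩ : ∃ B, ∀ i, Module.finrank k (Sections F (Q.star i)) ≤ B := by
    obtain ⟨B, hB⟩ := (Q.finite_range_star.image fun U => Module.finrank k (Sections F U)).bddAbove
    exact ⟨B, fun i => hB ⟨_, ⟨i, rfl⟩, rfl⟩⟩
  by_cases hbot : ∀ i, LinRel.relImage (starRel Q F i) ⊥ = ⊥
  · by_cases htop : ∀ i, LinRel.relImage (starRel Q F i) ⊤ = ⊤
    · exact Or.inr (hF.isLocallyConstantOfFiniteRank hbot htop)
    · obtain ⟨i, hi⟩ := not_forall.1 htop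
      exact Or.inl (LinRel.exists_isString_of_frequently_relImage_top_ne B hB
        (Q.frequently_star (p := fun U V => LinRel.relImage (agreeingPairs F U V) ⊤ ≠ ⊤) hi))
  · obtain ⟨i, hi⟩ := not_forall.1 hbot
    exact Or.inl (LinRel.exists_isString_of_frequently_relImage_bot_ne B hB
      (Q.frequently_star (p := fun U V => LinRel.relImage (agreeingPairs F U V) ⊥ ≠ ⊥) hi))

end IsAdapted

/-! ### Splitting data -/

/-- Transport of stalks along an equality of points. -/
def castStalk {X : TopCat.{u}} (F : Sh k X) {x y : X} (h : x = y) : Stalk F x →ₗ[k] Stalk F y :=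
  h ▸ LinearMap.id

@[simp] theorem castStalk_germ {X : TopCat.{u}} (F : Sh k X) {x y : X} (h : x = y) {U : Opens X}
    (hx : x ∈ U) (σ : Sections F U) :
    castStalk F h (germ F hx σ) = germ F (h ▸ hx : y ∈ U) σ := by
  subst h
  rfl

@[simp] theorem castStalk_self {X : TopCat.{u}} (F : Sh k X) {x : X} (h : x = x)
    (v : Stalk F x) : castStalk F h v = v := rfl

/-- Data on the inverse image `E` of `F` on the line that make `e_* k_I` a direct summand of `F`: a
section of `E` over the bounded set `I` and a morphism from `E` to `k_I`, pairing to one, such that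
the morphism kills all translates of the section in one direction by nonzero multiples of `2π`.
They are given by a vector and a linear form in every stalk. -/
structure SplitData (F : Sh k circle.{u}) (I : Set ℝ) where
  /-- The germs of the section over `I`, extended by zero. -/
  vec : ∀ c, Stalk F (toCircle c)
  /-- The stalks of the morphism to `k_I`. -/
  form : ∀ c, Module.Dual k (Stalk F (toCircle c))
  isBounded : Bornology.IsBounded I
  vec_eq_zero : ∀ c ∉ I, vec c = 0
  form_eq_zero : ∀ c ∉ I, form c = 0
  eventually_germ_eq : ∀ c ∈ I, ∃ (U : Opens circle.{u}) (_ : toCircle c ∈ U) (σ : Sections F U),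
    ∀ᶠ c' in 𝓝 c, ∀ h : toCircle c' ∈ U, germ F h σ = vec c'
  eventually_form_germ_eq : ∀ (U : Opens circle.{u}) (σ : Sections F U) (c : ℝ)
    (hc : toCircle c ∈ U), ∀ᶠ c' in 𝓝 c, ∀ h : toCircle c' ∈ U,
      (c ∈ I ∧ c' ∉ I) ∨ form c' (germ F h σ) = form c (germ F hc σ)
  pairing : ∀ c ∈ I, form c (vec c) = 1
  triangular : ∃ η : ℤˣ, ∀ (c : ℝ) (j : ℤ), 0 < η * j →
    form c (castStalk F (toCircle_add c j) (vec (c + 2 * Real.pi * j))) = 0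

theorem Grid.isBoundedInterval_idx_preimage_Icc (Q : Grid) {a b : ℤ} (hab : a ≤ b) :
    IsBoundedInterval (Q.idx ⁻¹' Set.Icc a b) where
  nonempty := ⟨Q.pt a, by simpa [Q.idx_pt] using hab⟩
  ordConnected := Set.ordConnected_Icc.preimage_mono Q.monotone_idx
  isBounded := by
    refine (Metric.isBounded_Icc (Q.pt (a - 1)) (Q.pt (b + 1))).subset fun c hc => ?_
    obtain ⟨hl, hr, -⟩ := Q.mem_cell_idx c
    exact ⟨(Q.strictMono_pt.monotone (sub_le_sub_right hc.1 1)).trans hl.le,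
      hr.le.trans (Q.strictMono_pt.monotone (add_le_add_left hc.2 1))⟩

theorem Grid.eventually_mem_cell (Q : Grid) {c : ℝ} {m : ℤ} (hc : c ∈ Q.cell m) :
    ∀ᶠ c' in 𝓝 c, c' ∈ Q.cell m ∨
      (∃ l, Odd l ∧ l + 1 = m ∧ Q.pt l < c' ∧ c' < Q.pt (l + 1)) ∨
      (Even m ∧ Q.pt m < c' ∧ c' < Q.pt (m + 1)) := by
  filter_upwards [eventually_gt_nhds hc.1, eventually_lt_nhds hc.2.1] with c' hl hr
  rcases Int.even_or_odd m with hm | hm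
  · rcases lt_trichotomy c' (Q.pt m) with h | rfl | h
    · exact Or.inr (Or.inl ⟨m - 1, hm.sub_odd odd_one, by ring, hl, by rwa [sub_add_cancel]⟩)
    · exact Or.inl (Q.pt_mem_cell m)
    · exact Or.inr (Or.inr ⟨hm, h, hr⟩)
  · exact Or.inl (Q.mem_cell_of_odd hm hl hr)

section Cellwise

variable {Q : Grid} {F : Sh k circle.{u}}

/-- The vectors in the stalks that are, on each cell, the germs of a section over the star. -/
def cellwiseGerm (x : ∀ n, Sections F (Q.star n)) (c : ℝ) : Stalk F (toCircle c) :=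
  germ F (Grid.toCircle_mem_star (Q.mem_cell_idx c)) (x (Q.idx c))

theorem cellwiseGerm_of_mem_cell (x : ∀ n, Sections F (Q.star n)) {c : ℝ} {m : ℤ}
    (h : c ∈ Q.cell m) : cellwiseGerm x c = germ F (Grid.toCircle_mem_star h) (x m) := by
  obtain rfl := Q.idx_eq_iff.2 h
  rfl

variable (hF : IsAdapted Q F)

include hF

/-- Sections over the star of the cell of `c` are determined by their germ at `c`. -/
def IsAdapted.starEquiv (c : ℝ) : Sections F (Q.star (Q.idx c)) ≃ₗ[k] Stalk F (toCircle c) :=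
  LinearEquiv.ofBijective _ (hF.germ_star_bijective (Q.mem_cell_idx c))

/-- The forms on the stalks that are, on each cell, induced by a form on sections over the star. -/
def IsAdapted.cellwiseForm (t : ∀ n, Module.Dual k (Sections F (Q.star n))) (c : ℝ) :
    Module.Dual k (Stalk F (toCircle c)) :=
  t (Q.idx c) ∘ₗ (hF.starEquiv c).symm.toLinearMap

theorem IsAdapted.cellwiseForm_germ (t : ∀ n, Module.Dual k (Sections F (Q.star n))) {c : ℝ}
    {m : ℤ} (h : c ∈ Q.cell m) (σ : Sections F (Q.star m)) :
    hF.cellwiseForm t c (germ F (Grid.toCircle_mem_star h) σ) = t m σ := by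
  obtain rfl := Q.idx_eq_iff.2 h
  exact congrArg (t _) ((hF.starEquiv c).symm_apply_apply σ)

theorem IsAdapted.eventually_germ_eq_cellwiseGerm {x : ∀ n, Sections F (Q.star n)} {c : ℝ} {m : ℤ}
    (hc : c ∈ Q.cell m) (hl : ∀ l, Odd l → l + 1 = m → (x l, x (l + 1)) ∈ starRel Q F l)
    (hr : Even m → (x m, x (m + 1)) ∈ starRel Q F m) :
    ∀ᶠ c' in 𝓝 c, ∀ h : toCircle c' ∈ Q.star m, germ F h (x m) = cellwiseGerm x c' := by
  filter_upwards [Q.eventually_mem_cell hc] with c' hc' h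
  rcases hc' with hc' | ⟨l, hlodd, rfl, hlc, hcm⟩ | ⟨hm, hmc, hcm⟩
  · exact (cellwiseGerm_of_mem_cell x hc').symm
  · rw [cellwiseGerm_of_mem_cell x (Q.mem_cell_left hlodd hlc hcm)]
    exact ((hF.mem_starRel hlc hcm).1 (hl l hlodd rfl)).symm
  · rw [cellwiseGerm_of_mem_cell x (Q.mem_cell_right hm hmc hcm)]
    exact (hF.mem_starRel hmc hcm).1 (hr hm)

theorem IsAdapted.eventually_cellwiseForm_germ_eq {p : ℤ → Prop}
    {t : ∀ n, Module.Dual k (Sections F (Q.star n))} {c : ℝ} {m : ℤ} (hc : c ∈ Q.cell m)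
    (hl : ∀ l, Odd l → l + 1 = m → ∀ q ∈ starRel Q F l, p l ∨ t l q.1 = t (l + 1) q.2)
    (hr : Even m → ∀ q ∈ starRel Q F m, p (m + 1) ∨ t (m + 1) q.2 = t m q.1)
    (σ : Sections F (Q.star m)) :
    ∀ᶠ c' in 𝓝 c, ∀ h : toCircle c' ∈ Q.star m,
      p (Q.idx c') ∨ hF.cellwiseForm t c' (germ F h σ) = t m σ := by
  filter_upwards [Q.eventually_mem_cell hc] with c' hc' h
  rcases hc' with hc' | ⟨l, hlodd, rfl, hlc, hcm⟩ | ⟨hm, hmc, hcm⟩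
  · exact Or.inr (hF.cellwiseForm_germ t hc' σ)
  · obtain ⟨ρ, hρ⟩ := hF.exists_mem_starRel_of_odd hlodd σ
    have hcell := Q.mem_cell_left hlodd hlc hcm
    rw [← (hF.mem_starRel hlc hcm).1 hρ, hF.cellwiseForm_germ t hcell, Q.idx_eq_iff.2 hcell]
    exact hl l hlodd rfl _ hρ
  · obtain ⟨ρ, hρ⟩ := hF.exists_mem_starRel_of_even hm σ
    have hcell := Q.mem_cell_right hm hmc hcm
    rw [(hF.mem_starRel hmc hcm).1 hρ, hF.cellwiseForm_germ t hcell, Q.idx_eq_iff.2 hcell]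
    exact hr hm _ hρ

end Cellwise

/-! ### A string gives splitting data -/

theorem res_mem_agreeingPairs {X : TopCat.{u}} {F : Sh k X} {U V U' V' : Opens X} (hU : U ≤ U')
    (hV : V ≤ V') {p : Sections F U' × Sections F V'} (h : p ∈ agreeingPairs F U' V') :
    (res F hU p.1, res F hV p.2) ∈ agreeingPairs F U V :=
  (res_res F _ _ _).trans <| (res_res F (inf_le_inf hU hV) _ _).symm.trans <|
    (congrArg _ h).trans <| (res_res F _ _ _).trans (res_res F _ _ _).symm

section IsString

variable {Q : Grid} {F : Sh k circle.{u}} (hF : IsAdapted Q F) {i n : ℤ}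
  {x : ∀ j, Sections F (Q.star j)} {t : ∀ j, Module.Dual k (Sections F (Q.star j))}
  (hs : LinRel.IsString (starRel Q F) i n x t)

include hF hs

theorem IsAdapted.left_mem_of_odd (hi : Odd i) : (0, x (i + 1)) ∈ starRel Q F i := by
  refine hs.left.resolve_right fun h => one_ne_zero (α := k) ?_
  obtain ⟨σ, hσ⟩ := hF.exists_mem_starRel_of_odd hi (x (i + 1))
  rw [← hs.pairing_eq_one le_rfl hs.le, h _ hσ]

theorem IsAdapted.left_form_eq_zero_of_even (hi : Even i) :
    ∀ p ∈ starRel Q F i, t (i + 1) p.2 = 0 := by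
  refine hs.left.resolve_left fun h => one_ne_zero (α := k) ?_
  rw [← hs.pairing_eq_one le_rfl hs.le, hF.right_eq_zero_of_even hi h, map_zero]

theorem IsAdapted.right_mem_of_even (hn : Even n) : (x n, 0) ∈ starRel Q F n := by
  refine hs.right.resolve_right fun h => one_ne_zero (α := k) ?_
  obtain ⟨τ, hτ⟩ := hF.exists_mem_starRel_of_even hn (x n)
  rw [← hs.pairing, h _ hτ]

theorem IsAdapted.right_form_eq_zero_of_odd (hn : Odd n) :
    ∀ p ∈ starRel Q F n, t n p.1 = 0 := by
  refine hs.right.resolve_left fun h => one_ne_zero (α := k) ?_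
  rw [← hs.pairing, hF.left_eq_zero_of_odd hn h, map_zero]

omit hF in
theorem form_res_eq_zero_of_base {a j : ℤ} (ha : i + 1 ≤ a) (haj : i + 1 ≤ a + Q.period * j)
    (hbase : t a (res F (Q.star_add a j).ge (x (a + Q.period * j))) = 0) {m m' : ℤ}
    (hm' : m' = m + Q.period * j) (ham : a ≤ m) (hm : m ≤ n) (hmn : m' ≤ n)
    (h : Q.star.{u} m ≤ Q.star m') : t m (res F h (x m')) = 0 := by
  induction m, ham using Int.leInduction generalizing m' with
  | base =>
    subst hm'
    exact hbase
  | succ m ham ih =>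
    obtain rfl : m' = m + Q.period * j + 1 := by omega
    have hstep := hs.dual_chain m (by omega) (by omega) _
      (res_mem_agreeingPairs (Q.star_add m j).ge h
        (hs.chain (m + Q.period * j) (by omega) (by omega)))
    exact hstep.symm.trans (ih rfl (by omega) (by omega) _)

theorem IsAdapted.form_res_eq_zero_of_odd (hi : Odd i) {j : ℤ} (hj : j < 0) {m m' : ℤ}
    (hm' : m' = m + Q.period * j) (him' : i + 1 ≤ m') (hm : m ≤ n) (h : Q.star.{u} m ≤ Q.star m') :
    t m (res F h (x m')) = 0 := by
  have hneg : Q.period * j < 0 := mul_neg_of_pos_of_neg Q.period_pos hj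
  obtain ⟨l, rfl⟩ : ∃ l, i = l + Q.period * j := ⟨i - Q.period * j, by ring⟩
  refine form_res_eq_zero_of_base hs (a := l + 1) (by omega) (by omega) ?_ hm' (by omega) hm
    (by omega) h
  have hbase : ∀ {b} (_ : b = l + Q.period * j + 1) (h : Q.star (l + 1) ≤ Q.star b),
      t (l + 1) (res F h (x b)) = 0 := by
    rintro _ rfl h
    have hstep := hs.dual_chain l (by omega) (by omega) _
      (res_mem_agreeingPairs (Q.star_add l j).ge h (hF.left_mem_of_odd hs hi))
    exact hstep.symm.trans (by simp only [map_zero])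
  exact hbase (by ring) _

theorem IsAdapted.form_res_eq_zero_of_even (hi : Even i) {j : ℤ} (hj : 0 < j) {m m' : ℤ}
    (hm' : m' = m + Q.period * j) (him : i + 1 ≤ m) (hmn : m' ≤ n) (h : Q.star.{u} m ≤ Q.star m') :
    t m (res F h (x m')) = 0 := by
  have hpos : 0 < Q.period * j := mul_pos Q.period_pos hj
  refine form_res_eq_zero_of_base hs (a := i + 1) le_rfl (by omega) ?_ hm' him (by omega) hmn h
  have hbase : ∀ {b} (_ : b = i + Q.period * j + 1) (h : Q.star (i + 1) ≤ Q.star b),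
      t (i + 1) (res F h (x b)) = 0 := by
    rintro _ rfl h
    exact hF.left_form_eq_zero_of_even hs hi _ (res_mem_agreeingPairs (Q.star_add i j).ge h
      (hs.chain (i + Q.period * j) (by omega) (by omega)))
  exact hbase (by ring) _

theorem IsAdapted.piecewise_mem_of_even {m : ℤ} (hm : Even m) (hmI : m ∈ Set.Icc (i + 1) n) :
    ((Set.Icc (i + 1) n).piecewise x 0 m, (Set.Icc (i + 1) n).piecewise x 0 (m + 1)) ∈
      starRel Q F m := by
  rw [Set.piecewise_eq_of_mem _ _ _ hmI]
  rcases hmI.2.lt_or_eq with h | rfl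
  · have hmI' : m + 1 ∈ Set.Icc (i + 1) n := ⟨by linarith [hmI.1], h⟩
    rw [Set.piecewise_eq_of_mem _ _ _ hmI']
    exact hs.chain m hmI.1 h
  · rw [Set.piecewise_eq_of_notMem _ _ _ (by simp)]
    exact hF.right_mem_of_even hs hm

theorem IsAdapted.piecewise_mem_of_odd {l : ℤ} (hl : Odd l) (hlI : l + 1 ∈ Set.Icc (i + 1) n) :
    ((Set.Icc (i + 1) n).piecewise x 0 l, (Set.Icc (i + 1) n).piecewise x 0 (l + 1)) ∈
      starRel Q F l := by
  rw [Set.piecewise_eq_of_mem _ _ _ hlI]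
  rcases (show i ≤ l by simpa using hlI.1).lt_or_eq with h | rfl
  · have hlI' : l ∈ Set.Icc (i + 1) n := ⟨h, by linarith [hlI.2]⟩
    rw [Set.piecewise_eq_of_mem _ _ _ hlI']
    exact hs.chain l h hlI.2
  · rw [Set.piecewise_eq_of_notMem _ _ _ (by simp)]
    exact hF.left_mem_of_odd hs hl

theorem IsAdapted.piecewise_form_of_even {m : ℤ} (hm : Even m) {p : _ × _}
    (hp : p ∈ starRel Q F m) :
    (m ∈ Set.Icc (i + 1) n ∧ m + 1 ∉ Set.Icc (i + 1) n) ∨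
      (Set.Icc (i + 1) n).piecewise t 0 (m + 1) p.2 = (Set.Icc (i + 1) n).piecewise t 0 m p.1 := by
  by_cases h : m ∈ Set.Icc (i + 1) n <;> by_cases h' : m + 1 ∈ Set.Icc (i + 1) n
  · right
    rw [Set.piecewise_eq_of_mem _ _ _ h, Set.piecewise_eq_of_mem _ _ _ h']
    exact (hs.dual_chain m h.1 h'.2 p hp).symm
  · exact Or.inl ⟨h, h'⟩
  · right
    obtain rfl : m = i := by simp only [Set.mem_Icc] at h h'; omega
    rw [Set.piecewise_eq_of_notMem _ _ _ h, Set.piecewise_eq_of_mem _ _ _ h']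
    exact hF.left_form_eq_zero_of_even hs hm p hp
  · right
    rw [Set.piecewise_eq_of_notMem _ _ _ h, Set.piecewise_eq_of_notMem _ _ _ h']
    rfl

theorem IsAdapted.piecewise_form_of_odd {l : ℤ} (hl : Odd l) {p : _ × _}
    (hp : p ∈ starRel Q F l) :
    (l + 1 ∈ Set.Icc (i + 1) n ∧ l ∉ Set.Icc (i + 1) n) ∨
      (Set.Icc (i + 1) n).piecewise t 0 l p.1 = (Set.Icc (i + 1) n).piecewise t 0 (l + 1) p.2 := by
  by_cases h : l ∈ Set.Icc (i + 1) n <;> by_cases h' : l + 1 ∈ Set.Icc (i + 1) n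
  · right
    rw [Set.piecewise_eq_of_mem _ _ _ h, Set.piecewise_eq_of_mem _ _ _ h']
    exact hs.dual_chain l h.1 h'.2 p hp
  · right
    obtain rfl : l = n := by simp only [Set.mem_Icc] at h h'; omega
    rw [Set.piecewise_eq_of_mem _ _ _ h, Set.piecewise_eq_of_notMem _ _ _ h']
    exact hF.right_form_eq_zero_of_odd hs hl p hp
  · exact Or.inl ⟨h', h⟩
  · right
    rw [Set.piecewise_eq_of_notMem _ _ _ h, Set.piecewise_eq_of_notMem _ _ _ h']
    rfl

theorem IsAdapted.cellwiseForm_cellwiseGerm_eq_zero {c : ℝ} {j : ℤ}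
    (hj : 0 < (if Even i then 1 else -1 : ℤˣ) * j) :
    hF.cellwiseForm ((Set.Icc (i + 1) n).piecewise t 0) c (castStalk F (toCircle_add c j)
      (cellwiseGerm ((Set.Icc (i + 1) n).piecewise x 0) (c + 2 * Real.pi * j))) = 0 := by
  have hidx := Q.idx_add c j
  have hstar : Q.star.{u} (Q.idx c) ≤ Q.star (Q.idx (c + 2 * Real.pi * j)) := by
    rw [hidx, Q.star_add]
  have hc := Q.mem_cell_idx c
  rw [cellwiseGerm, castStalk_germ, ← germ_res F hstar (Grid.toCircle_mem_star hc),
    hF.cellwiseForm_germ _ hc]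
  by_cases h : Q.idx c ∈ Set.Icc (i + 1) n <;>
    by_cases h' : Q.idx (c + 2 * Real.pi * j) ∈ Set.Icc (i + 1) n
  · rw [Set.piecewise_eq_of_mem _ _ _ h, Set.piecewise_eq_of_mem _ _ _ h']
    split_ifs at hj with hi
    · exact hF.form_res_eq_zero_of_even hs hi (by simpa using hj) hidx h.1 h'.2 _
    · exact hF.form_res_eq_zero_of_odd hs (Int.not_even_iff_odd.1 hi) (by simpa using hj) hidx h'.1
        h.2 _
  · rw [Set.piecewise_eq_of_notMem _ _ _ h']
    simp only [Pi.zero_apply, map_zero]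
  · rw [Set.piecewise_eq_of_notMem _ _ _ h]
    rfl
  · rw [Set.piecewise_eq_of_notMem _ _ _ h]
    rfl

/-- The splitting data given by a string, supported on the cells with indices in `[i + 1, n]`. -/
def IsAdapted.splitData : SplitData F (Q.idx ⁻¹' Set.Icc (i + 1) n) where
  vec := cellwiseGerm ((Set.Icc (i + 1) n).piecewise x 0)
  form := hF.cellwiseForm ((Set.Icc (i + 1) n).piecewise t 0)
  isBounded := (Q.isBoundedInterval_idx_preimage_Icc hs.le).isBounded
  vec_eq_zero c hc := by
    rw [cellwiseGerm, Set.piecewise_eq_of_notMem (Set.Icc (i + 1) n) _ _ hc]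
    exact map_zero _
  form_eq_zero c hc := by
    rw [IsAdapted.cellwiseForm, Set.piecewise_eq_of_notMem (Set.Icc (i + 1) n) _ _ hc]
    exact LinearMap.zero_comp _
  eventually_germ_eq c hc := ⟨Q.star (Q.idx c), Grid.toCircle_mem_star (Q.mem_cell_idx c), _,
    hF.eventually_germ_eq_cellwiseGerm (Q.mem_cell_idx c)
      (fun _ hl hlc => hF.piecewise_mem_of_odd hs hl (hlc ▸ hc))
      (fun hm => hF.piecewise_mem_of_even hs hm hc)⟩
  eventually_form_germ_eq U σ c hc := by
    have hcell := Q.mem_cell_idx c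
    obtain ⟨σ', hσ'⟩ := (hF.germ_star_bijective hcell).2 (germ F hc σ)
    obtain ⟨W, hcW, hW', hW, hres⟩ := exists_res_eq_of_germ_eq F _ _ hσ'
    filter_upwards [eventually_toCircle_mem hcW, hF.eventually_cellwiseForm_germ_eq
      (p := fun m => Q.idx c ∈ Set.Icc (i + 1) n ∧ m ∉ Set.Icc (i + 1) n) hcell
      (fun l hl hlc q hq => hlc ▸ hF.piecewise_form_of_odd hs hl hq)
      (fun hm q hq => hF.piecewise_form_of_even hs hm hq) σ'] with c' hc'W hc' h
    rw [← hσ', hF.cellwiseForm_germ _ hcell, ← germ_res F hW hc'W, ← hres, germ_res]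
    exact hc' (hW' hc'W)
  pairing c hc := by
    have hc : Q.idx c ∈ Set.Icc (i + 1) n := hc
    rw [cellwiseGerm, hF.cellwiseForm_germ _ (Q.mem_cell_idx c), Set.piecewise_eq_of_mem _ _ _ hc,
      Set.piecewise_eq_of_mem _ _ _ hc]
    exact hs.pairing_eq_one hc.1 hc.2
  triangular := ⟨_, fun c j hj => hF.cellwiseForm_cellwiseGerm_eq_zero hs hj⟩

end IsString

/-! ### Direct images of interval sheaves -/

/-- The sheaf `e_* k_I`. -/
abbrev pushInterval (k : Type u) [Field k] (I : Set ℝ) : Sh k circle.{u} :=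
  (eDirectImage k).obj (intervalSheaf k I 1)

section PushInterval

variable {I : Set ℝ} {U V : Opens circle.{u}} {c : ℝ}

/-- The value at `c` of a section of `e_* k_I`, viewed as a function on the inverse image of `U` in
the line. -/
def valueAt (h : toCircle c ∈ U) : Module.Dual k (Sections (pushInterval k I) U) where
  toFun φ := (show extSections k line.{u} (ULift.down ⁻¹' I) (Fin 1 → k) ((Opens.map e).obj U)
    from φ).1 ⟨ULift.up c, h⟩ 0
  map_add' _ _ := rfl
  map_smul' _ _ := rfl

theorem valueAt_res (hUV : U ≤ V) (h : toCircle c ∈ U) (φ : Sections (pushInterval k I) V) :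
    valueAt h (res _ hUV φ) = valueAt (hUV h) φ := rfl

theorem pushInterval_ext {φ ψ : Sections (pushInterval k I) U}
    (H : ∀ c (h : toCircle c ∈ U), valueAt h φ = valueAt h ψ) : φ = ψ := by
  apply Subtype.ext
  funext ⟨⟨c⟩, h⟩ a
  obtain rfl : a = 0 := Subsingleton.elim _ _
  exact H c h

theorem eventually_preimage_iff (h : toCircle c ∈ U) {p : (Opens.map e).obj U → Prop} :
    (∀ᶠ y in 𝓝 (⟨ULift.up c, h⟩ : (Opens.map e).obj U), p y) ↔
      ∀ᶠ c' in 𝓝 c, ∀ h' : toCircle c' ∈ U, p ⟨ULift.up c', h'⟩ := by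
  have hmap : Filter.map ULift.up.{u} (𝓝 c) = 𝓝 (ULift.up c) :=
    Homeomorph.ulift.symm.map_nhds_eq c
  have hcomap : 𝓝 (⟨ULift.up c, h⟩ : (Opens.map e).obj U) =
      Filter.comap Subtype.val (Filter.map ULift.up.{u} (𝓝 c)) :=
    nhds_subtype_eq_comap.trans (congrArg _ hmap.symm)
  rw [hcomap]
  refine Filter.eventually_comap.trans (Filter.eventually_map.trans ?_)
  refine Filter.eventually_congr (Filter.Eventually.of_forall fun c' => ⟨fun H h' => H _ rfl, ?_⟩)
  rintro H ⟨_, h'⟩ rfl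
  exact H h'

theorem eventually_valueAt_eq_zero (φ : Sections (pushInterval k I) U) (h : toCircle c ∈ U)
    (hc : c ∉ I) : ∀ᶠ c' in 𝓝 c, ∀ h' : toCircle c' ∈ U, valueAt h' φ = 0 := by
  filter_upwards [(eventually_preimage_iff h).1 (((isExtSection_iff _ _).1 φ.2 _).1 hc)]
    with c' hc' h' using congrFun (hc' h') 0

theorem eventually_valueAt_eq (φ : Sections (pushInterval k I) U) (h : toCircle c ∈ U)
    (hc : c ∈ I) : ∀ᶠ c' in 𝓝 c, c' ∈ I → ∀ h' : toCircle c' ∈ U, valueAt h' φ = valueAt h φ := by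
  filter_upwards [(eventually_preimage_iff h).1 (((isExtSection_iff _ _).1 φ.2 _).2 hc)]
    with c' hc' hI h' using congrFun (hc' h' hI) 0

theorem valueAt_eq_zero (φ : Sections (pushInterval k I) U) (h : toCircle c ∈ U) (hc : c ∉ I) :
    valueAt h φ = 0 :=
  (eventually_valueAt_eq_zero φ h hc).self_of_nhds h

theorem exists_forall_valueAt_eq (f : ∀ c, toCircle c ∈ U → k)
    (h0 : ∀ c (_ : toCircle c ∈ U), c ∉ I → ∀ᶠ c' in 𝓝 c, ∀ h', f c' h' = 0)
    (h1 : ∀ c (h : toCircle c ∈ U), c ∈ I → ∀ᶠ c' in 𝓝 c, c' ∈ I → ∀ h', f c' h' = f c h) :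
    ∃ φ : Sections (pushInterval k I) U, ∀ c (h : toCircle c ∈ U), valueAt h φ = f c h := by
  refine ⟨⟨fun y _ => f y.1.down y.2, ?_⟩, fun c h => rfl⟩
  refine (isExtSection_iff (V := Fin 1 → k) (U := ((Opens.map e).obj U : Set line.{u})) _ _).2 ?_
  rintro ⟨⟨c⟩, h⟩
  refine ⟨fun hc => (eventually_preimage_iff h).2 ?_, fun hc => (eventually_preimage_iff h).2 ?_⟩
  · filter_upwards [h0 c h hc] with c' hc' h' using funext fun _ => hc' h'
  · filter_upwards [h1 c h hc] with c' hc' h' hI using funext fun _ => hc' hI h'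

end PushInterval

/-! ### The direct summand defined by splitting data -/

/-- The translates of `c` by multiples of `2π` are the points of the line over its image in the
circle. -/
def translateEquiv (c : ℝ) : ℤ ≃ {c' : ℝ // toCircle.{u} c' = toCircle c} :=
  Equiv.ofBijective (fun j => ⟨c + 2 * Real.pi * j, toCircle_add c j⟩) <| by
    refine ⟨fun i j hij => ?_, fun c' => ?_⟩
    · simpa using hij
    · obtain ⟨j, hj⟩ := toCircle_eq_toCircle_iff.1 c'.2.symm
      exact ⟨j, Subtype.ext hj.symm⟩

theorem exists_finset_translates {I : Set ℝ} (hI : Bornology.IsBounded I) (c : ℝ) :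
    ∃ J : Finset ℤ, ∀ᶠ c' in 𝓝 c, ∀ j : ℤ, c' + 2 * Real.pi * j ∈ I → j ∈ J := by
  obtain ⟨R, hR⟩ := hI.exists_norm_le
  refine ⟨Finset.Icc ⌈(-R - 1 - c) / (2 * Real.pi)⌉ ⌊(R + 1 - c) / (2 * Real.pi)⌋, ?_⟩
  filter_upwards [Ioo_mem_nhds (sub_one_lt c) (lt_add_one c)] with c' hc' j hj
  obtain ⟨hl, hr⟩ := abs_le.1 (hR _ hj)
  rw [Finset.mem_Icc, Int.ceil_le, Int.le_floor, div_le_iff₀ Real.two_pi_pos,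
    le_div_iff₀ Real.two_pi_pos]
  constructor <;> linarith [hc'.1, hc'.2]

namespace SplitData

variable {F : Sh k circle.{u}} {I : Set ℝ} (D : SplitData F I)

theorem exists_valueAt_eq_form {U : Opens circle.{u}} (σ : Sections F U) :
    ∃ φ : Sections (pushInterval k I) U, ∀ c (h : toCircle c ∈ U),
      valueAt h φ = D.form c (germ F h σ) := by
  refine exists_forall_valueAt_eq _ (fun c h hc => ?_) fun c h _ => ?_
  · filter_upwards [D.eventually_form_germ_eq U σ c h] with c' hc' h'
    rw [(hc' h').resolve_left (fun hcI => hc hcI.1), D.form_eq_zero c hc, LinearMap.zero_apply]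
  · filter_upwards [D.eventually_form_germ_eq U σ c h] with c' hc' hI h'
    exact (hc' h').resolve_left fun hcI => hcI.2 hI

/-- The morphism `F ⟶ e_* k_I`. -/
def toPush : F ⟶ pushInterval k I :=
  homMk
    (fun U =>
      { toFun σ := (D.exists_valueAt_eq_form σ).choose
        map_add' σ τ := pushInterval_ext fun c h => by
          rw [map_add, (D.exists_valueAt_eq_form _).choose_spec,
            (D.exists_valueAt_eq_form σ).choose_spec, (D.exists_valueAt_eq_form τ).choose_spec,
            map_add, map_add]
        map_smul' a σ := pushInterval_ext fun c h => by
          rw [map_smul, (D.exists_valueAt_eq_form _).choose_spec,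
            (D.exists_valueAt_eq_form σ).choose_spec, map_smul, map_smul, RingHom.id_apply] })
    fun U V hUV σ => pushInterval_ext fun c h => by
      rw [valueAt_res]
      exact ((D.exists_valueAt_eq_form _).choose_spec c h).trans <|
        (congrArg _ (germ_res F hUV h σ)).trans
          ((D.exists_valueAt_eq_form σ).choose_spec c (hUV h)).symm

theorem valueAt_toPush {U : Opens circle.{u}} (σ : Sections F U) {c : ℝ} (h : toCircle c ∈ U) :
    valueAt h (mapSections D.toPush U σ) = D.form c (germ F h σ) :=
  (D.exists_valueAt_eq_form σ).choose_spec c h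

variable {U : Opens circle.{u}} (φ : Sections (pushInterval k I) U)

/-- The germ at `x` of the image in `F` of a section of `e_* k_I`: the sum over the points `c`
above `x` of the value at `c` times the vector of the splitting data at `c`. -/
def fromPushGerm (x : circle.{u}) (hx : x ∈ U) : Stalk F x :=
  ∑ᶠ a : {c : ℝ // toCircle.{u} c = x},
    valueAt (show toCircle a.1 ∈ U by rwa [a.2]) φ • castStalk F a.2 (D.vec a.1)

theorem fromPushGerm_eq_sum {c : ℝ} (hc : toCircle c ∈ U) {J : Finset ℤ}
    (hJ : ∀ j : ℤ, c + 2 * Real.pi * j ∈ I → j ∈ J) :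
    D.fromPushGerm φ (toCircle c) hc = ∑ j ∈ J,
      valueAt (show toCircle (c + 2 * Real.pi * j) ∈ U by rwa [toCircle_add]) φ •
        castStalk F (toCircle_add c j) (D.vec (c + 2 * Real.pi * j)) := by
  rw [fromPushGerm, ← finsum_comp_equiv (translateEquiv c)]
  refine finsum_eq_sum_of_support_subset _ fun j hj => hJ j ?_
  by_contra hI
  refine hj ?_
  change valueAt _ φ • castStalk F _ (D.vec (c + 2 * Real.pi * j)) = 0
  rw [D.vec_eq_zero _ hI, map_zero, smul_zero]

theorem exists_germ_eq_smul_vec {c : ℝ} (hc : toCircle c ∈ U) :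
    ∃ (W : Opens circle.{u}) (_ : toCircle c ∈ W) (τ : Sections F W), ∀ᶠ c' in 𝓝 c,
      ∀ (h : toCircle c' ∈ W) (h' : toCircle c' ∈ U), germ F h τ = valueAt h' φ • D.vec c' := by
  by_cases hI : c ∈ I
  · obtain ⟨W, hcW, σ, hσ⟩ := D.eventually_germ_eq c hI
    refine ⟨W, hcW, valueAt hc φ • σ, ?_⟩
    filter_upwards [hσ, eventually_valueAt_eq φ hc hI] with c' hvec hval h h'
    rw [map_smul, hvec h]
    by_cases hI' : c' ∈ I
    · rw [hval hI' h']
    · rw [D.vec_eq_zero c' hI', smul_zero, smul_zero]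
  · refine ⟨⊤, Opens.mem_top _, 0, ?_⟩
    filter_upwards [eventually_valueAt_eq_zero φ hc hI] with c' hval h h'
    rw [hval h', zero_smul, map_zero]

theorem exists_germ_eq_smul_castStalk_vec {c : ℝ} (hc : toCircle c ∈ U) (j : ℤ) :
    ∃ (W : Opens circle.{u}) (_ : toCircle c ∈ W) (τ : Sections F W), ∀ᶠ c' in 𝓝 c,
      ∀ (h : toCircle c' ∈ W) (h' : toCircle (c' + 2 * Real.pi * j) ∈ U),
        germ F h τ =
          valueAt h' φ • castStalk F (toCircle_add c' j) (D.vec (c' + 2 * Real.pi * j)) := by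
  obtain ⟨W, hW, τ, hτ⟩ := D.exists_germ_eq_smul_vec φ (c := c + 2 * Real.pi * j)
    (by rwa [toCircle_add])
  refine ⟨W, by rwa [← toCircle_add c j], τ, ?_⟩
  have htendsto : Filter.Tendsto (fun c' : ℝ => c' + 2 * Real.pi * j) (𝓝 c)
      (𝓝 (c + 2 * Real.pi * j)) := (continuous_add_const _).tendsto c
  filter_upwards [htendsto.eventually hτ] with c' hc' h h'
  rw [← map_smul, ← hc' (by rwa [toCircle_add]) h', castStalk_germ]

theorem exists_eventually_germ_eq_fromPushGerm {c : ℝ} (hc : toCircle c ∈ U) :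
    ∃ (W : Opens circle.{u}) (_ : toCircle c ∈ W) (τ : Sections F W), ∀ᶠ c' in 𝓝 c,
      ∀ (h : toCircle c' ∈ W) (h' : toCircle c' ∈ U),
        germ F h τ = D.fromPushGerm φ (toCircle c') h' := by
  obtain ⟨J, hJ⟩ := exists_finset_translates D.isBounded c
  choose W hcW τ hτ using D.exists_germ_eq_smul_castStalk_vec φ hc
  refine ⟨J.inf W, ?_, ∑ j : J, res F (Finset.inf_le j.2) (τ j), ?_⟩
  · rw [← SetLike.mem_coe, Opens.coe_finset_inf]
    simp [hcW]
  · filter_upwards [hJ, (Filter.eventually_all_finset J).2 fun j _ => hτ j] with c' hc'J hc' h h'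
    rw [D.fromPushGerm_eq_sum φ h' hc'J, map_sum, ← Finset.sum_coe_sort J]
    refine Finset.sum_congr rfl fun j _ => ?_
    rw [germ_res, hc' j j.2]

theorem exists_germ_eq_fromPushGerm :
    ∃ σ : Sections F U, ∀ x (hx : x ∈ U), germ F hx σ = D.fromPushGerm φ x hx := by
  refine exists_section_germ_eq F _ fun x hx => ?_
  obtain ⟨c, rfl⟩ := toCircle_surjective x
  obtain ⟨W, hcW, τ, hτ⟩ := D.exists_eventually_germ_eq_fromPushGerm φ hx
  obtain ⟨N, hN, hNo, hcN⟩ := eventually_nhds_iff.1 (show ∀ᶠ y in 𝓝 (toCircle c),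
    ∀ (h : y ∈ W) (h' : y ∈ U), germ F h τ = D.fromPushGerm φ y h' from
      isOpenMap_toCircle.nhds_le c hτ)
  exact ⟨⟨N, hNo⟩ ⊓ W ⊓ U, ⟨⟨hcN, hcW⟩, hx⟩, inf_le_right,
    res F (inf_le_left.trans inf_le_right) τ, fun y hy => by rw [germ_res, hN y hy.1.1]⟩

theorem fromPushGerm_add (ψ : Sections (pushInterval k I) U) {x : circle.{u}} (hx : x ∈ U) :
    D.fromPushGerm (φ + ψ) x hx = D.fromPushGerm φ x hx + D.fromPushGerm ψ x hx := by
  obtain ⟨c, rfl⟩ := toCircle_surjective x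
  obtain ⟨J, hJ⟩ := exists_finset_translates D.isBounded c
  simp only [D.fromPushGerm_eq_sum _ hx hJ.self_of_nhds, map_add, add_smul, Finset.sum_add_distrib]

theorem fromPushGerm_smul (a : k) {x : circle.{u}} (hx : x ∈ U) :
    D.fromPushGerm (a • φ) x hx = a • D.fromPushGerm φ x hx := by
  simp only [fromPushGerm, map_smul, smul_assoc, smul_finsum]

/-- The morphism `e_* k_I ⟶ F`. -/
def fromPush : pushInterval k I ⟶ F :=
  homMk
    (fun U =>
      { toFun φ := (D.exists_germ_eq_fromPushGerm φ).choose
        map_add' φ ψ := section_ext F fun x hx => by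
          rw [map_add, (D.exists_germ_eq_fromPushGerm _).choose_spec,
            (D.exists_germ_eq_fromPushGerm φ).choose_spec,
            (D.exists_germ_eq_fromPushGerm ψ).choose_spec, fromPushGerm_add]
        map_smul' a φ := section_ext F fun x hx => by
          rw [map_smul, (D.exists_germ_eq_fromPushGerm _).choose_spec,
            (D.exists_germ_eq_fromPushGerm φ).choose_spec, fromPushGerm_smul, RingHom.id_apply] })
    fun U V hUV φ => section_ext F fun x hx => by
      simp only [LinearMap.coe_mk, AddHom.coe_mk, germ_res,
        (D.exists_germ_eq_fromPushGerm _).choose_spec]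
      rfl

theorem germ_fromPush {x : circle.{u}} (hx : x ∈ U) :
    germ F hx (mapSections D.fromPush U φ) = D.fromPushGerm φ x hx :=
  (D.exists_germ_eq_fromPushGerm φ).choose_spec x hx

theorem valueAt_fromPush_toPush {c : ℝ} (hc : toCircle c ∈ U) {J : Finset ℤ}
    (hJ : ∀ j : ℤ, c + 2 * Real.pi * j ∈ I → j ∈ J) :
    valueAt hc (mapSections (D.fromPush ≫ D.toPush) U φ) = ∑ j ∈ J,
      valueAt (show toCircle (c + 2 * Real.pi * j) ∈ U by rwa [toCircle_add]) φ *
        D.form c (castStalk F (toCircle_add c j) (D.vec (c + 2 * Real.pi * j))) := by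
  rw [mapSections_comp, valueAt_toPush, germ_fromPush, D.fromPushGerm_eq_sum φ hc hJ, map_sum]
  simp only [map_smul, smul_eq_mul]

end SplitData

theorem hom_ext_of_mapSections {X : TopCat.{u}} {F G : Sh k X} {f g : F ⟶ G}
    (h : ∀ U s, mapSections f U s = mapSections g U s) : f = g := by
  apply ObjectProperty.hom_ext
  ext U s
  exact h U.unop s

namespace SplitData

variable {F : Sh k circle.{u}} {I : Set ℝ} (D : SplitData F I)

/-- The endomorphism `1 - f` of `e_* k_I`, where `f` is the composition `e_* k_I ⟶ F ⟶ e_* k_I`. -/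
def defect : End (pushInterval.{u} k I) :=
  1 - End.of (D.fromPush ≫ D.toPush)

theorem valueAt_defect_self {U : Opens circle.{u}} (φ : Sections (pushInterval k I) U) {c : ℝ}
    (hc : toCircle c ∈ U) : valueAt hc (mapSections D.defect U φ) =
      valueAt hc φ - valueAt hc (mapSections (D.fromPush ≫ D.toPush) U φ) := rfl

theorem valueAt_defect_eq_zero {η : ℤˣ} (hη : ∀ (c : ℝ) (j : ℤ), 0 < η * j →
      D.form c (castStalk F (toCircle_add c j) (D.vec (c + 2 * Real.pi * j))) = 0)
    {U : Opens circle.{u}} {φ : Sections (pushInterval k I) U} {b : ℝ}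
    (hφ : ∀ (c : ℝ) (hc : toCircle c ∈ U), (η : ℤ) * c < b → valueAt hc φ = 0)
    {c : ℝ} (hc : toCircle c ∈ U) (hcb : (η : ℤ) * c < b + 2 * Real.pi) :
    valueAt hc (mapSections D.defect U φ) = 0 := by
  by_cases hI : c ∈ I
  swap
  · exact valueAt_eq_zero _ hc hI
  obtain ⟨J, hJ⟩ := exists_finset_translates D.isBounded c
  have hJ := hJ.self_of_nhds
  have hdiag : ∀ {c'} (_ : c' = c) (h : toCircle c' = toCircle c) (hc' : toCircle c' ∈ U),
      valueAt hc' φ * D.form c (castStalk F h (D.vec c')) = valueAt hc φ := by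
    rintro _ rfl _ _
    rw [castStalk_self, D.pairing _ hI, mul_one]
  rw [valueAt_defect_self, D.valueAt_fromPush_toPush φ hc hJ, Finset.sum_eq_single (0 : ℤ),
    hdiag (by simp), sub_self]
  · intro j _ hj
    rcases (mul_ne_zero η.ne_zero hj).lt_or_gt with hneg | hpos
    · have hle : ((η : ℤ) : ℝ) * j ≤ -1 := by exact_mod_cast Int.le_sub_one_of_lt hneg
      rw [hφ _ _ (by nlinarith [Real.two_pi_pos]), zero_mul]
    · rw [hη c j hpos, mul_zero]
  · exact fun h => absurd (hJ 0 (by simpa using hI)) h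

theorem isNilpotent_defect : IsNilpotent D.defect := by
  obtain ⟨η, hη⟩ := D.triangular
  obtain ⟨R, hR⟩ := D.isBounded.exists_norm_le
  have hRη : ∀ c ∈ I, |((η : ℤ) : ℝ) * c| ≤ R := fun c hc => by
    rcases Int.units_eq_one_or η with rfl | rfl <;> simpa using hR c hc
  have hvanish : ∀ (r : ℕ) (U : Opens circle.{u}) (φ : Sections (pushInterval k I) U) (c : ℝ)
      (hc : toCircle c ∈ U), (η : ℤ) * c < -R + 2 * Real.pi * r →
        valueAt hc (mapSections (D.defect ^ r) U φ) = 0 := by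
    intro r U φ
    induction r with
    | zero =>
      refine fun c hc hcR => valueAt_eq_zero _ hc fun hI => ?_
      linarith [(abs_le.1 (hRη c hI)).1, show (η : ℤ) * c < -R by simpa using hcR]
    | succ r ih =>
      intro c hc hcR
      rw [pow_succ']
      refine D.valueAt_defect_eq_zero hη ih hc (hcR.trans_eq ?_)
      push_cast
      ring
  obtain ⟨r, hr⟩ := exists_nat_gt (2 * R / (2 * Real.pi))
  rw [div_lt_iff₀ Real.two_pi_pos] at hr
  refine ⟨r, hom_ext_of_mapSections fun U φ => pushInterval_ext fun c hc => ?_⟩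
  by_cases hI : c ∈ I
  · exact hvanish r U φ c hc (by linarith [(abs_le.1 (hRη c hI)).2])
  · rw [valueAt_eq_zero _ hc hI, valueAt_eq_zero _ hc hI]

instance isIso_fromPush_toPush : IsIso (D.fromPush ≫ D.toPush) := by
  have hunit : IsUnit (End.of (D.fromPush ≫ D.toPush)) := by
    simpa only [defect, sub_sub_cancel] using D.isNilpotent_defect.isUnit_one_sub
  exact (isUnit_iff_isIso _).1 hunit

instance isSplitEpi_toPush : IsSplitEpi D.toPush :=
  IsSplitEpi.mk' ⟨inv (D.fromPush ≫ D.toPush) ≫ D.fromPush, by simp⟩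

theorem not_surjective_mapSections_kernel_ι {U : Opens circle.{u}} {c : ℝ} (hc : toCircle c ∈ U)
    (hI : c ∈ I) (hU : Function.Surjective (germ F hc)) :
    ¬ Function.Surjective (mapSections (kernel.ι D.toPush) U) := by
  intro hsurj
  obtain ⟨σ, hσ⟩ := hU (D.vec c)
  obtain ⟨τ, rfl⟩ := hsurj σ
  have hpair := D.pairing c hI
  rw [← hσ, ← valueAt_toPush, ← mapSections_comp, kernel.condition] at hpair
  exact zero_ne_one hpair

end SplitData

/-! ### The decomposition -/

section Biproducts

variable {C : Type*} [Category* C] [Preadditive C]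

theorem isSplitMono_kernel_ι {X Y : C} (f : X ⟶ Y) [IsSplitEpi f] [HasKernel f] :
    IsSplitMono (kernel.ι f) :=
  IsSplitMono.mk' ⟨(binaryBiconeOfIsSplitEpiOfKernel (kernelIsKernel f)).fst,
    (binaryBiconeOfIsSplitEpiOfKernel (kernelIsKernel f)).inl_fst⟩

/-- The source of a split epimorphism is the biproduct of its kernel and its target. -/
def isoKernelBiprod {X Y : C} (f : X ⟶ Y) [IsSplitEpi f] [HasKernel f]
    [HasBinaryBiproducts C] : X ≅ kernel f ⊞ Y :=
  biprod.uniqueUpToIso _ _ (isBilimitBinaryBiconeOfIsSplitEpiOfKernel (kernelIsKernel f))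

/-- A biproduct indexed by `Fin (m + 1)` is the biproduct of the first summand and the others. -/
def biproductSuccIso [HasFiniteBiproducts C] [HasBinaryBiproducts C] {m : ℕ}
    (g : Fin (m + 1) → C) : ⨁ g ≅ g 0 ⊞ ⨁ fun a : Fin m => g a.succ where
  hom := biprod.lift (biproduct.π g 0) (biproduct.lift fun a => biproduct.π g a.succ)
  inv := biprod.desc (biproduct.ι g 0) (biproduct.desc fun a => biproduct.ι g a.succ)
  hom_inv_id := by
    rw [biprod.lift_desc, biproduct.lift_desc, ← biproduct.total, Fin.sum_univ_succ]
  inv_hom_id := by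
    ext a b
    · simp
    · simp [biproduct.ι_π_ne _ (Fin.succ_ne_zero _).symm]
    · simp [biproduct.ι_π_ne _ (Fin.succ_ne_zero _)]
    · rcases eq_or_ne a b with rfl | hab
      · simp
      · simp [biproduct.ι_π_ne _ hab, biproduct.ι_π_ne _ ((Fin.succ_injective _).ne hab)]

end Biproducts

variable {Q : Grid} {F G : Sh k circle.{u}}

/-- The total dimension of the spaces of sections over the stars of a grid. -/
def totalRank (Q : Grid) (F : Sh k circle.{u}) : ℕ :=
  ∑ j ∈ Finset.Ico 0 Q.period, Module.finrank k (Sections F (Q.star j))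

theorem mapSections_injective_of_isSplitMono (i : G ⟶ F) [IsSplitMono i] (U : Opens circle.{u}) :
    Function.Injective (mapSections i U) :=
  Function.LeftInverse.injective (g := mapSections (retraction i) U) fun s => by
    rw [← mapSections_comp, IsSplitMono.id, mapSections_id]

theorem IsAdapted.totalRank_lt (hF : IsAdapted Q F) (i : G ⟶ F) [IsSplitMono i] {n : ℤ}
    (hn : ¬ Function.Surjective (mapSections i (Q.star n))) : totalRank Q G < totalRank Q F := by
  have hfin := hF.finite_sections
  refine Finset.sum_lt_sum (fun j _ => LinearMap.finrank_le_finrank_of_injective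
    (mapSections_injective_of_isSplitMono i (Q.star j))) ⟨n % Q.period, ?_, ?_⟩
  · exact Finset.mem_Ico.2 ⟨Int.emod_nonneg _ Q.period_pos.ne', Int.emod_lt_of_pos _ Q.period_pos⟩
  · have hstar : Q.star.{u} (n % Q.period) = Q.star n := by
      rw [← Q.star_add _ (n / Q.period), Int.emod_add_mul_ediv]
    rw [hstar,
      ← LinearMap.finrank_range_of_inj (mapSections_injective_of_isSplitMono i (Q.star n))]
    exact Submodule.finrank_lt fun htop => hn (LinearMap.range_eq_top.1 htop)

theorem IsAdapted.isLocallyConstantOfFiniteRank_or_exists_summand (hF : IsAdapted Q F) :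
    IsLocallyConstantOfFiniteRank F ∨
      ∃ (G : Sh k circle.{u}) (I : Set ℝ), IsAdapted Q G ∧ totalRank Q G < totalRank Q F ∧
        IsBoundedInterval I ∧ Nonempty (F ≅ G ⊞ pushInterval k I) := by
  refine hF.exists_isString_or_isLocallyConstantOfFiniteRank.symm.imp_right ?_
  rintro ⟨i, n, x, t, hs⟩
  have D := hF.splitData hs
  have hsplit := isSplitMono_kernel_ι D.toPush
  have hmem : Q.pt (i + 1) ∈ Q.idx ⁻¹' Set.Icc (i + 1) n := by simpa [Q.idx_pt] using hs.le
  exact ⟨kernel D.toPush, _, hF.of_retract (IsSplitMono.id (kernel.ι D.toPush)),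
    hF.totalRank_lt (kernel.ι D.toPush) (D.not_surjective_mapSections_kernel_ι _ hmem
      (hF.germ_star_bijective (Q.pt_mem_cell (i + 1))).2),
    Q.isBoundedInterval_idx_preimage_Icc hs.le, ⟨isoKernelBiprod D.toPush⟩⟩

/-- `F` is the direct sum of a locally constant sheaf of finite rank and finitely many sheaves
`e_* k^n_I`, where the `I` are bounded intervals. -/
def HasIntervalDecomposition (F : Sh k circle.{u}) : Prop :=
  ∃ (L : Sh k circle.{u}) (m : ℕ) (I : Fin m → Set ℝ) (n : Fin m → ℕ),
    IsLocallyConstantOfFiniteRank L ∧ (∀ a, IsBoundedInterval (I a)) ∧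
    Nonempty (F ≅ L ⊞ ⨁ fun a => (eDirectImage k).obj (intervalSheaf k (I a) (n a)))

theorem IsLocallyConstantOfFiniteRank.hasIntervalDecomposition
    (hF : IsLocallyConstantOfFiniteRank F) : HasIntervalDecomposition F := by
  refine ⟨F, 0, Fin.elim0, Fin.elim0, hF, fun a => a.elim0, ⟨isoBiprodZero ?_⟩⟩
  rw [IsZero.iff_id_eq_zero]
  ext a
  exact a.elim0

theorem HasIntervalDecomposition.of_iso_biprod {I : Set ℝ} (hG : HasIntervalDecomposition G)
    (hI : IsBoundedInterval I) (i : F ≅ G ⊞ pushInterval k I) : HasIntervalDecomposition F := by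
  obtain ⟨L, m, J, n, hL, hJ, ⟨j⟩⟩ := hG
  refine ⟨L, m + 1, Fin.cons I J, Fin.cons 1 n, hL, fun a => Fin.cases hI hJ a, ⟨?_⟩⟩
  let P : Fin (m + 1) → Sh k circle.{u} := fun a => (eDirectImage k).obj
    (intervalSheaf k ((Fin.cons I J : Fin (m + 1) → Set ℝ) a)
      ((Fin.cons 1 n : Fin (m + 1) → ℕ) a))
  let consIso : pushInterval k I ⊞
      (⨁ fun a => (eDirectImage k).obj (intervalSheaf k (J a) (n a))) ≅ ⨁ P :=
    (biproductSuccIso P).symm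
  exact i ≪≫ biprod.mapIso j (Iso.refl _) ≪≫ biprod.associator _ _ _ ≪≫
    biprod.mapIso (Iso.refl _) (biprod.braiding _ _ ≪≫ consIso)

theorem IsAdapted.hasIntervalDecomposition {F : Sh k circle.{u}} (hF : IsAdapted Q F) :
    HasIntervalDecomposition F := by
  induction h : totalRank Q F using Nat.strong_induction_on generalizing F with
  | _ d ih =>
    subst h
    rcases hF.isLocallyConstantOfFiniteRank_or_exists_summand with hL | ⟨G, I, hG, hlt, hI, ⟨i⟩⟩
    · exact hL.hasIntervalDecomposition
    · exact (ih _ hlt hG rfl).of_iso_biprod hI i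

end

end CircleSheaf

theorem mainTheorem6 {k : Type*} [Field k] (F : CircleSheaf.Sh k CircleSheaf.circle)
    (hF : CircleSheaf.IsConstructible F) :
    ∃ (L : CircleSheaf.Sh k CircleSheaf.circle) (m : ℕ) (I : Fin m → Set ℝ) (n : Fin m → ℕ),
      CircleSheaf.IsLocallyConstantOfFiniteRank L ∧
      (∀ a, CircleSheaf.IsBoundedInterval (I a)) ∧
      Nonempty (F ≅ L ⊞ ⨁ fun a =>
        (CircleSheaf.eDirectImage k).obj (CircleSheaf.intervalSheaf k (I a) (n a))) := by
  obtain ⟨Q, hQ⟩ := hF.exists_isAdapted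
  exact hQ.hasIntervalDecomposition
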